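/- Let $0<\beta<1/2$ and $0\le\theta\le1$. All functions are real-valued on $(0,1)$. Let $H^1(0,1)$ be the space of functions in $L^2(0,1)$ with weak derivative $Dw\in L^2(0,1)$. For $\mu>0$ put $$\|w\|_{H^\mu(\mathbb R)}=\bigl(\|w\|_{L^2(\mathbb R)}^2+\||\omega|^\mu\mathcal F(w)\|_{L^2(\mathbb R)}^2\bigr)^{1/2},$$ where $\mathcal F$ is the Fourier transform, and let $H^\mu_0(0,1)$ be the completion of $C_0^\infty(0,1)$ in this norm, that is, the space of those $u\in L^2(0,1)$ whose extension by zero to $\mathbb R$ is the limit in $\|\cdot\|_{H^\mu(\mathbb R)}$ of a sequence in $C_0^\infty(0,1)$. Define the two-sided fractional integral $$I^\beta_\theta\phi(x)=\frac{\theta}{\Gamma(\beta)}\int_0^x\frac{\phi(s)}{(x-s)^{1-\beta}}\,ds+\frac{1-\theta}{\Gamma(\beta)}\int_x^1\frac{\phi(s)}{(s-x)^{1-\beta}}\,ds$$ and $$\mathcal R(I^\beta_\theta)=\{w\in H^1(0,1):\ w=I^\beta_\theta\phi\ \text{for some}\ \phi\in H^{1-\beta}_0(0,1)\}.$$ There is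 exactly one map $P:H^1(0,1)\to H^1_0(0,1)$ such that $$(D Pw,Dv)_{L^2(0,1)}=(Dw,Dv)_{L^2(0,1)}\qquad\text{for all } w\in H^1(0,1),\ v\in H^1_0(0,1),$$ and it is linear. With $\mathcal N(P)=\{w\in H^1(0,1): Pw=0\}$ the following hold: $$\mathcal N(P)=\operatorname{span}\{1-x,\;x\},\qquad P\bigl(\mathcal R(I^\beta_\theta)\bigr)=H^1_0(0,1),\qquad H^1(0,1)=\mathcal R(I^\beta_\theta)\oplus\mathcal N(P).$$ -/

import Mathlib

open MeasureTheory Set Filter Topology FourierTransform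
open scoped ENNReal

namespace FracDiff

/-- Lebesgue measure on the open interval `(0, 1)`. -/
noncomputable abbrev vol01 : Measure ℝ := volume.restrict (Ioo (0 : ℝ) 1)

/-- The real Hilbert space `L²(0, 1)`. -/
noncomputable abbrev L2 : Type := Lp ℝ 2 vol01

/-- The open interval `(0, 1)` as a bundled open set. -/
def Omega : TopologicalSpace.Opens ℝ := ⟨Ioo (0 : ℝ) 1, isOpen_Ioo⟩

/-- `C₀^∞(0, 1)`: smooth real functions with compact support contained in `(0, 1)`.
The order `⊤ : ℕ∞` means infinitely differentiable. -/
abbrev Test : Type := TestFunction Omega ℝ (⊤ : ℕ∞)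

/-! ### Weak derivatives and `H¹(0, 1)` -/

/-- `g ∈ L²(0, 1)` is the weak derivative of `w ∈ L²(0, 1)` on `(0, 1)`. -/
def HasWeakDeriv (w g : L2) : Prop :=
  ∀ φ : Test, ∫ x in Ioo (0 : ℝ) 1, w x * deriv φ x = -∫ x in Ioo (0 : ℝ) 1, g x * φ x

theorem L2_integrable (w : L2) : Integrable w vol01 :=
  (Lp.memLp w).integrable (by norm_num)

theorem test_integrable (φ : Test) (w : L2) : Integrable (fun x => w x * φ x) vol01 := by
  obtain ⟨C, hC⟩ := φ.continuous.bounded_above_of_compact_support φ.hasCompactSupport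
  exact (L2_integrable w).mul_bdd (c := C) φ.continuous.aestronglyMeasurable (ae_of_all _ hC)

theorem test_deriv_integrable (φ : Test) (w : L2) :
    Integrable (fun x => w x * deriv φ x) vol01 := by
  have hc : Continuous (deriv φ) := φ.contDiff.continuous_deriv (by simp)
  obtain ⟨C, hC⟩ := hc.bounded_above_of_compact_support φ.hasCompactSupport.deriv
  exact (L2_integrable w).mul_bdd (c := C) hc.aestronglyMeasurable (ae_of_all _ hC)

theorem HasWeakDeriv.add {w g w' g' : L2} (h : HasWeakDeriv w g) (h' : HasWeakDeriv w' g') :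
    HasWeakDeriv (w + w') (g + g') := by
  intro φ
  have e1 : ∫ x in Ioo (0 : ℝ) 1, (w + w' : L2) x * deriv φ x
      = ∫ x in Ioo (0 : ℝ) 1, (w x * deriv φ x + w' x * deriv φ x) := by
    refine integral_congr_ae ?_
    filter_upwards [Lp.coeFn_add w w'] with x hx
    rw [hx, Pi.add_apply, add_mul]
  have e2 : ∫ x in Ioo (0 : ℝ) 1, (g + g' : L2) x * φ x
      = ∫ x in Ioo (0 : ℝ) 1, (g x * φ x + g' x * φ x) := by
    refine integral_congr_ae ?_
    filter_upwards [Lp.coeFn_add g g'] with x hx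
    rw [hx, Pi.add_apply, add_mul]
  rw [e1, e2, integral_add (test_deriv_integrable φ w) (test_deriv_integrable φ w'),
    integral_add (test_integrable φ g) (test_integrable φ g'), h φ, h' φ, neg_add]

theorem HasWeakDeriv.smul {w g : L2} (c : ℝ) (h : HasWeakDeriv w g) :
    HasWeakDeriv (c • w) (c • g) := by
  intro φ
  have e1 : ∫ x in Ioo (0 : ℝ) 1, (c • w : L2) x * deriv φ x
      = ∫ x in Ioo (0 : ℝ) 1, c * (w x * deriv φ x) := by
    refine integral_congr_ae ?_
    filter_upwards [Lp.coeFn_smul c w] with x hx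
    rw [hx, Pi.smul_apply, smul_eq_mul, mul_assoc]
  have e2 : ∫ x in Ioo (0 : ℝ) 1, (c • g : L2) x * φ x
      = ∫ x in Ioo (0 : ℝ) 1, c * (g x * φ x) := by
    refine integral_congr_ae ?_
    filter_upwards [Lp.coeFn_smul c g] with x hx
    rw [hx, Pi.smul_apply, smul_eq_mul, mul_assoc]
  rw [e1, e2, integral_const_mul, integral_const_mul, h φ, mul_neg]

/-- Weak derivatives are unique. -/
theorem HasWeakDeriv.unique {w g g' : L2} (h : HasWeakDeriv w g) (h' : HasWeakDeriv w g') :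
    g = g' := by
  have hloc : LocallyIntegrableOn (fun x => g x - g' x) (Ioo (0 : ℝ) 1) volume :=
    IntegrableOn.locallyIntegrableOn ((L2_integrable g).sub (L2_integrable g'))
  have key := isOpen_Ioo.ae_eq_zero_of_integral_contDiff_smul_eq_zero hloc (by
    intro φ h1 h2 h3
    let ψ : Test := ⟨φ, h1, h2, h3⟩
    have e : ∫ x in Ioo (0 : ℝ) 1, (g x * φ x - g' x * φ x) = 0 := by
      have := integral_sub (test_integrable ψ g) (test_integrable ψ g')
      have h4 := h ψ
      rw [h' ψ] at h4
      have h5 : ∫ x in Ioo (0 : ℝ) 1, g x * ψ x = ∫ x in Ioo (0 : ℝ) 1, g' x * ψ x := by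
        linarith
      rw [h5, sub_self] at this
      exact this
    rw [← e, ← integral_indicator measurableSet_Ioo]
    refine integral_congr_ae (ae_of_all _ fun x => ?_)
    by_cases hx : x ∈ Ioo (0 : ℝ) 1
    · simp only [indicator_of_mem hx, smul_eq_mul]; ring
    · have : φ x = 0 := by
        by_contra hne
        exact hx (h3 (subset_tsupport _ hne))
      simp [indicator_of_notMem hx, this])
  refine Lp.ext ?_
  filter_upwards [(ae_restrict_iff' measurableSet_Ioo).2 key] with x hx
  linarith

/-- `H¹(0, 1)`: the square integrable functions that have a square integrable weak derivative. -/
noncomputable def H1 : Submodule ℝ L2 where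
  carrier := {w | ∃ g : L2, HasWeakDeriv w g}
  add_mem' := by
    rintro w w' ⟨g, hg⟩ ⟨g', hg'⟩
    exact ⟨g + g', hg.add hg'⟩
  zero_mem' := by
    refine ⟨0, ?_⟩
    intro φ
    have e (f : ℝ → ℝ) : ∫ x in Ioo (0 : ℝ) 1, (0 : L2) x * f x = 0 := by
      refine integral_eq_zero_of_ae ?_
      filter_upwards [Lp.coeFn_zero ℝ 2 vol01] with x hx
      have hx' : (0 : L2) x = 0 := hx
      simp only [hx', zero_mul, Pi.zero_apply]
    rw [e, e, neg_zero]
  smul_mem' := by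
    rintro c w ⟨g, hg⟩
    exact ⟨c • g, hg.smul c⟩

/-- The weak derivative `D : H¹(0, 1) → L²(0, 1)`. -/
noncomputable def D : H1 →ₗ[ℝ] L2 where
  toFun w := w.2.choose
  map_add' w w' :=
    (w + w').2.choose_spec.unique (w.2.choose_spec.add w'.2.choose_spec)
  map_smul' c w := (c • w).2.choose_spec.unique (w.2.choose_spec.smul c)

theorem D_spec (w : H1) : HasWeakDeriv (w : L2) (D w) := w.2.choose_spec

/-! ### The spaces `H^μ₀(0, 1)` -/

/-- The seminorm `|f|_{H^μ(ℝ)} = ‖ |ω|^μ 𝓕 f ‖_{L²(ℝ)}` of an integrable function `f : ℝ → ℝ`.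
(Mathlib's `𝓕` uses the kernel `exp(-2πixω)`; the choice of normalisation
only changes the seminorm by a constant factor.) -/
noncomputable def sobolevSeminorm (μ : ℝ) (f : ℝ → ℝ) : ℝ≥0∞ :=
  eLpNorm (fun ω : ℝ => ((|ω| ^ μ : ℝ) : ℂ) * 𝓕 (fun x => (f x : ℂ)) ω) 2 volume

/-- The norm `‖f‖_{H^μ(ℝ)} = (‖f‖²_{L²(ℝ)} + |f|²_{H^μ(ℝ)})^{1/2}`. -/
noncomputable def sobolevNorm (μ : ℝ) (f : ℝ → ℝ) : ℝ≥0∞ :=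
  (eLpNorm f 2 volume ^ 2 + sobolevSeminorm μ f ^ 2) ^ (1 / 2 : ℝ)

/-- The extension of `u ∈ L²(0, 1)` by zero to the real line. -/
noncomputable def zeroExt (u : L2) : ℝ → ℝ := (Ioo (0 : ℝ) 1).indicator u

theorem zeroExt_integrable (u : L2) : Integrable (zeroExt u) :=
  (integrable_indicator_iff measurableSet_Ioo).2 (L2_integrable u)

theorem zeroExt_add (u v : L2) : zeroExt (u + v) =ᵐ[volume] zeroExt u + zeroExt v := by
  have := (ae_restrict_iff' measurableSet_Ioo).1 (Lp.coeFn_add u v)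
  filter_upwards [this] with x hx
  by_cases h : x ∈ Ioo (0 : ℝ) 1
  · simpa only [zeroExt, indicator_of_mem h, Pi.add_apply, Pi.smul_apply] using hx h
  · simp [zeroExt, indicator_of_notMem h]

theorem zeroExt_smul (c : ℝ) (u : L2) : zeroExt (c • u) =ᵐ[volume] c • zeroExt u := by
  have := (ae_restrict_iff' measurableSet_Ioo).1 (Lp.coeFn_smul c u)
  filter_upwards [this] with x hx
  by_cases h : x ∈ Ioo (0 : ℝ) 1
  · simpa only [zeroExt, indicator_of_mem h, Pi.add_apply, Pi.smul_apply] using hx h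
  · simp [zeroExt, indicator_of_notMem h]

theorem sobolevSeminorm_congr (μ : ℝ) {f g : ℝ → ℝ} (h : f =ᵐ[volume] g) :
    sobolevSeminorm μ f = sobolevSeminorm μ g := by
  have : 𝓕 (fun x => (f x : ℂ)) = 𝓕 (fun x => (g x : ℂ)) := by
    ext ω
    rw [Real.fourier_eq, Real.fourier_eq]
    refine integral_congr_ae ?_
    filter_upwards [h] with x hx
    simp only [hx]
  rw [sobolevSeminorm, sobolevSeminorm, this]

theorem sobolevNorm_congr (μ : ℝ) {f g : ℝ → ℝ} (h : f =ᵐ[volume] g) :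
    sobolevNorm μ f = sobolevNorm μ g := by
  rw [sobolevNorm, sobolevNorm, sobolevSeminorm_congr μ h, eLpNorm_congr_ae h]

theorem fourier_aesm {f : ℝ → ℝ} (hf : Integrable f) (μ : ℝ) :
    AEStronglyMeasurable
      (fun ω : ℝ => ((|ω| ^ μ : ℝ) : ℂ) * 𝓕 (fun x => (f x : ℂ)) ω) volume := by
  have h1 : Continuous (𝓕 (fun x => (f x : ℂ))) :=
    VectorFourier.fourierIntegral_continuous Real.continuous_fourierChar
      (by exact continuous_inner) hf.ofReal
  have h2 : Measurable (fun ω : ℝ => ((|ω| ^ μ : ℝ) : ℂ)) := by fun_prop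
  exact h2.aestronglyMeasurable.mul h1.aestronglyMeasurable

theorem sobolevSeminorm_add_le (μ : ℝ) {f g : ℝ → ℝ} (hf : Integrable f) (hg : Integrable g) :
    sobolevSeminorm μ (f + g) ≤ sobolevSeminorm μ f + sobolevSeminorm μ g := by
  have e : (fun ω : ℝ => ((|ω| ^ μ : ℝ) : ℂ) * 𝓕 (fun x => ((f + g) x : ℂ)) ω)
      = (fun ω : ℝ => ((|ω| ^ μ : ℝ) : ℂ) * 𝓕 (fun x => (f x : ℂ)) ω)
        + fun ω : ℝ => ((|ω| ^ μ : ℝ) : ℂ) * 𝓕 (fun x => (g x : ℂ)) ω := by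
    ext ω
    have : 𝓕 (fun x => ((f + g) x : ℂ)) ω
        = 𝓕 (fun x => (f x : ℂ)) ω + 𝓕 (fun x => (g x : ℂ)) ω := by
      rw [Real.fourier_eq, Real.fourier_eq, Real.fourier_eq, ← integral_add]
      · simp [smul_add]
      · exact (Real.fourierIntegral_convergent_iff ω).2 hf.ofReal
      · exact (Real.fourierIntegral_convergent_iff ω).2 hg.ofReal
    simp only [Pi.add_apply] at this ⊢
    rw [this, mul_add]
  rw [sobolevSeminorm, e]
  exact eLpNorm_add_le (fourier_aesm hf μ) (fourier_aesm hg μ) (by norm_num)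

theorem sobolevSeminorm_smul (μ c : ℝ) (f : ℝ → ℝ) :
    sobolevSeminorm μ (c • f) = ‖c‖ₑ * sobolevSeminorm μ f := by
  have e : (fun ω : ℝ => ((|ω| ^ μ : ℝ) : ℂ) * 𝓕 (fun x => ((c • f) x : ℂ)) ω)
      = c • (fun ω : ℝ => ((|ω| ^ μ : ℝ) : ℂ) * 𝓕 (fun x => (f x : ℂ)) ω) := by
    ext ω
    have : 𝓕 (fun x => ((c • f) x : ℂ)) ω = c * 𝓕 (fun x => (f x : ℂ)) ω := by
      rw [Real.fourier_eq, Real.fourier_eq, ← integral_const_mul]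
      refine integral_congr_ae (ae_of_all _ fun x => ?_)
      simp only [Pi.smul_apply, smul_eq_mul, Complex.ofReal_mul, Circle.smul_def]
      ring
    simp only [Pi.smul_apply, Complex.real_smul] at this ⊢
    rw [this]
    ring
  rw [sobolevSeminorm, e, eLpNorm_const_smul, sobolevSeminorm]

theorem tendsto_sobolevNorm_iff {μ : ℝ} {F : ℕ → ℝ → ℝ} :
    Tendsto (fun n => sobolevNorm μ (F n)) atTop (𝓝 0) ↔
      Tendsto (fun n => eLpNorm (F n) 2 volume) atTop (𝓝 0) ∧
      Tendsto (fun n => sobolevSeminorm μ (F n)) atTop (𝓝 0) := by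
  have hs (a : ℝ≥0∞) : (a ^ 2) ^ (1 / 2 : ℝ) = a := by
    rw [← ENNReal.rpow_natCast, ← ENNReal.rpow_mul]
    norm_num
  constructor
  · intro h
    refine ⟨tendsto_of_tendsto_of_tendsto_of_le_of_le tendsto_const_nhds h
      (fun _ => zero_le) fun n => ?_,
      tendsto_of_tendsto_of_tendsto_of_le_of_le tendsto_const_nhds h
      (fun _ => zero_le) fun n => ?_⟩
    · exact (hs _).symm.le.trans (ENNReal.rpow_le_rpow le_self_add (by norm_num))
    · exact (hs _).symm.le.trans (ENNReal.rpow_le_rpow le_add_self (by norm_num))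
  · rintro ⟨h1, h2⟩
    have h3 := ((ENNReal.continuous_rpow_const (y := (1 / 2 : ℝ))).tendsto _).comp
      (((ENNReal.continuous_pow 2).tendsto _).comp h1 |>.add
        (((ENNReal.continuous_pow 2).tendsto _).comp h2))
    simpa [Function.comp_def, sobolevNorm] using h3

theorem test_integrable' (φ : Test) : Integrable (φ : ℝ → ℝ) :=
  φ.continuous.integrable_of_hasCompactSupport φ.hasCompactSupport

/-- `H^μ₀(0, 1)`: the completion of `C₀^∞(0, 1)` for the norm `‖·‖_{H^μ(ℝ)}`, realised inside
`L²(0, 1)` as the set of all `u` whose extension by zero is the limit, in the norm of `H^μ(ℝ)`,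
of a sequence of test functions. -/
noncomputable def Hzero (μ : ℝ) : Submodule ℝ L2 where
  carrier := {u | ∃ φ : ℕ → Test,
    Tendsto (fun n => sobolevNorm μ (⇑(φ n) - zeroExt u)) atTop (𝓝 0)}
  add_mem' := by
    rintro u v ⟨φ, hφ⟩ ⟨ψ, hψ⟩
    refine ⟨fun n => φ n + ψ n, ?_⟩
    have e (n : ℕ) : sobolevNorm μ (⇑(φ n + ψ n) - zeroExt (u + v))
        = sobolevNorm μ ((⇑(φ n) - zeroExt u) + (⇑(ψ n) - zeroExt v)) := by
      refine sobolevNorm_congr μ ?_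
      filter_upwards [zeroExt_add u v] with x hx
      simp only [Pi.sub_apply, Pi.add_apply, hx, FunLike.coe_add]
      ring
    simp only [e]
    have iφ (n : ℕ) := (test_integrable' (φ n)).sub (zeroExt_integrable u)
    have iψ (n : ℕ) := (test_integrable' (ψ n)).sub (zeroExt_integrable v)
    rw [tendsto_sobolevNorm_iff] at hφ hψ ⊢
    constructor
    · refine tendsto_of_tendsto_of_tendsto_of_le_of_le tendsto_const_nhds
        (by simpa using hφ.1.add hψ.1) (fun _ => zero_le) fun n => ?_
      exact eLpNorm_add_le (iφ n).aestronglyMeasurable (iψ n).aestronglyMeasurable (by norm_num)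
    · refine tendsto_of_tendsto_of_tendsto_of_le_of_le tendsto_const_nhds
        (by simpa using hφ.2.add hψ.2) (fun _ => zero_le) fun n => ?_
      exact sobolevSeminorm_add_le μ (iφ n) (iψ n)
  zero_mem' := by
    refine ⟨fun _ => 0, ?_⟩
    have e : sobolevNorm μ (⇑(0 : Test) - zeroExt 0) = 0 := by
      have e1 : sobolevNorm μ (⇑(0 : Test) - zeroExt 0)
          = sobolevNorm μ ((0 : ℝ) • (0 : ℝ → ℝ)) := by
        refine sobolevNorm_congr μ ?_
        filter_upwards [zeroExt_smul 0 0] with x hx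
        simp only [zero_smul, Pi.zero_apply, Pi.sub_apply] at hx ⊢
        rw [hx, sub_zero, FunLike.coe_zero, Pi.zero_apply]
      rw [e1, sobolevNorm, sobolevSeminorm_smul]
      simp
    rw [tendsto_congr fun _ => e]
    exact tendsto_const_nhds
  smul_mem' := by
    rintro c u ⟨φ, hφ⟩
    refine ⟨fun n => c • φ n, ?_⟩
    have e (n : ℕ) : sobolevNorm μ (⇑(c • φ n) - zeroExt (c • u))
        = sobolevNorm μ (c • (⇑(φ n) - zeroExt u)) := by
      refine sobolevNorm_congr μ ?_
      filter_upwards [zeroExt_smul c u] with x hx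
      simp only [Pi.sub_apply, Pi.smul_apply, hx, FunLike.coe_smul, smul_eq_mul]
      ring
    simp only [e]
    rw [tendsto_sobolevNorm_iff] at hφ ⊢
    simp only [sobolevSeminorm_smul, eLpNorm_const_smul]
    exact ⟨by simpa using ENNReal.Tendsto.const_mul hφ.1 (Or.inr (enorm_ne_top (x := c))),
      by simpa using ENNReal.Tendsto.const_mul hφ.2 (Or.inr (enorm_ne_top (x := c)))⟩

/-- `H¹₀(0, 1)` as a subspace of `H¹(0, 1)`. -/
noncomputable def H10 : Submodule ℝ H1 := (Hzero 1).comap H1.subtype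

/-! ### The two-sided fractional integral and its range -/

/-- The left fractional integral of order `σ` on `(0, 1)`. -/
noncomputable def leftInt (σ : ℝ) (w : ℝ → ℝ) (x : ℝ) : ℝ :=
  1 / Real.Gamma σ * ∫ s in Ioo 0 x, w s / (x - s) ^ (1 - σ)

/-- The right fractional integral of order `σ` on `(0, 1)`. -/
noncomputable def rightInt (σ : ℝ) (w : ℝ → ℝ) (x : ℝ) : ℝ :=
  1 / Real.Gamma σ * ∫ s in Ioo x 1, w s / (s - x) ^ (1 - σ)

/-- The two-sided fractional integral `I^β_θ`. -/
noncomputable def fracInt (β θ : ℝ) (w : ℝ → ℝ) (x : ℝ) : ℝ :=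
  θ * leftInt β w x + (1 - θ) * rightInt β w x

theorem ae_integrable_left {β : ℝ} (hβ : 0 < β) (w : L2) :
    ∀ᵐ x ∂vol01, IntegrableOn (fun s => w s / (x - s) ^ (1 - β)) (Ioo 0 x) := by
  have hk : Integrable ((Ioo (0 : ℝ) 1).indicator fun t => t ^ (β - 1)) :=
    (integrable_indicator_iff measurableSet_Ioo).2
      ((intervalIntegral.integrableOn_Ioo_rpow_iff one_pos).2 (by linarith))
  have h := (zeroExt_integrable w).ae_convolution_exists (ContinuousLinearMap.mul ℝ ℝ) hk
  refine (ae_restrict_iff' measurableSet_Ioo).2 ?_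
  filter_upwards [h] with x hx hx01
  refine (Integrable.integrableOn (s := Ioo 0 x) hx).congr_fun (fun s hs => ?_) measurableSet_Ioo
  have h1 : s ∈ Ioo (0 : ℝ) 1 := ⟨hs.1, hs.2.trans hx01.2⟩
  have h2 : x - s ∈ Ioo (0 : ℝ) 1 := ⟨sub_pos.2 hs.2, by linarith [hs.1, hx01.2]⟩
  simp only [ContinuousLinearMap.mul_apply', zeroExt, indicator_of_mem h1, indicator_of_mem h2]
  rw [div_eq_mul_inv, ← Real.rpow_neg h2.1.le, neg_sub]

theorem ae_integrable_right {β : ℝ} (hβ : 0 < β) (w : L2) :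
    ∀ᵐ x ∂vol01, IntegrableOn (fun s => w s / (s - x) ^ (1 - β)) (Ioo x 1) := by
  have hk0 : Integrable ((Ioo (0 : ℝ) 1).indicator fun t => t ^ (β - 1)) :=
    (integrable_indicator_iff measurableSet_Ioo).2
      ((intervalIntegral.integrableOn_Ioo_rpow_iff one_pos).2 (by linarith))
  have hk := hk0.comp_neg
  have h := (zeroExt_integrable w).ae_convolution_exists (ContinuousLinearMap.mul ℝ ℝ) hk
  refine (ae_restrict_iff' measurableSet_Ioo).2 ?_
  filter_upwards [h] with x hx hx01
  refine (Integrable.integrableOn (s := Ioo x 1) hx).congr_fun (fun s hs => ?_) measurableSet_Ioo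
  have h1 : s ∈ Ioo (0 : ℝ) 1 := ⟨hx01.1.trans hs.1, hs.2⟩
  have h2 : s - x ∈ Ioo (0 : ℝ) 1 := ⟨sub_pos.2 hs.1, by linarith [hs.2, hx01.1]⟩
  simp only [ContinuousLinearMap.mul_apply', zeroExt, neg_sub, indicator_of_mem h1,
    indicator_of_mem h2]
  rw [div_eq_mul_inv, ← Real.rpow_neg h2.1.le, neg_sub]

theorem fracInt_add {β θ : ℝ} (hβ : 0 < β) (u v : L2) :
    fracInt β θ (u + v : L2) =ᵐ[vol01] fracInt β θ u + fracInt β θ v := by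
  have h0 := (ae_restrict_iff' measurableSet_Ioo).1 (Lp.coeFn_add u v)
  filter_upwards [ae_integrable_left hβ u, ae_integrable_left hβ v, ae_integrable_right hβ u,
    ae_integrable_right hβ v, ae_restrict_mem measurableSet_Ioo] with x h1 h2 h3 h4 hx
  have e1 : leftInt β (u + v : L2) x = leftInt β u x + leftInt β v x := by
    rw [leftInt, leftInt, leftInt, ← mul_add, ← integral_add h1 h2]
    congr 1
    refine setIntegral_congr_ae measurableSet_Ioo ?_
    filter_upwards [h0] with s hs hs'
    rw [hs ⟨hs'.1, hs'.2.trans hx.2⟩, Pi.add_apply, add_div]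
  have e2 : rightInt β (u + v : L2) x = rightInt β u x + rightInt β v x := by
    rw [rightInt, rightInt, rightInt, ← mul_add, ← integral_add h3 h4]
    congr 1
    refine setIntegral_congr_ae measurableSet_Ioo ?_
    filter_upwards [h0] with s hs hs'
    rw [hs ⟨hx.1.trans hs'.1, hs'.2⟩, Pi.add_apply, add_div]
  simp only [fracInt, Pi.add_apply, e1, e2]
  ring

theorem fracInt_smul {β θ : ℝ} (c : ℝ) (u : L2) :
    fracInt β θ (c • u : L2) =ᵐ[vol01] c • fracInt β θ u := by
  have h0 := (ae_restrict_iff' measurableSet_Ioo).1 (Lp.coeFn_smul c u)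
  filter_upwards [ae_restrict_mem measurableSet_Ioo] with x hx
  have e1 : leftInt β (c • u : L2) x = c * leftInt β u x := by
    rw [leftInt, leftInt, mul_left_comm c, ← integral_const_mul c]
    congr 1
    refine setIntegral_congr_ae measurableSet_Ioo ?_
    filter_upwards [h0] with s hs hs'
    rw [hs ⟨hs'.1, hs'.2.trans hx.2⟩, Pi.smul_apply, smul_eq_mul, mul_div_assoc]
  have e2 : rightInt β (c • u : L2) x = c * rightInt β u x := by
    rw [rightInt, rightInt, mul_left_comm c, ← integral_const_mul c]
    congr 1
    refine setIntegral_congr_ae measurableSet_Ioo ?_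
    filter_upwards [h0] with s hs hs'
    rw [hs ⟨hx.1.trans hs'.1, hs'.2⟩, Pi.smul_apply, smul_eq_mul, mul_div_assoc]
  simp only [fracInt, Pi.smul_apply, smul_eq_mul, e1, e2]
  ring

/-- The range `R(I^β_θ)`: all `w ∈ H¹(0, 1)` of the form `w = I^β_θ φ` (almost everywhere) with
`φ ∈ H^{1-β}₀(0, 1)`. -/
noncomputable def fracRange (β θ : ℝ) (hβ : 0 < β) : Submodule ℝ H1 where
  carrier := {w | ∃ φ ∈ Hzero (1 - β), ((w : L2) : ℝ → ℝ) =ᵐ[vol01] fracInt β θ φ}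
  add_mem' := by
    rintro w w' ⟨φ, hφ, h⟩ ⟨φ', hφ', h'⟩
    refine ⟨φ + φ', add_mem hφ hφ', ?_⟩
    filter_upwards [Lp.coeFn_add (w : L2) (w' : L2), fracInt_add (θ := θ) hβ φ φ', h, h']
      with x h1 h2 h3 h4
    rw [Submodule.coe_add, h1, h2, Pi.add_apply, Pi.add_apply, h3, h4]
  zero_mem' := by
    refine ⟨0, zero_mem _, ?_⟩
    have h2 := fracInt_smul (β := β) (θ := θ) 0 0
    rw [zero_smul, zero_smul] at h2
    filter_upwards [Lp.coeFn_zero ℝ 2 vol01, h2] with x h1 h2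
    rw [ZeroMemClass.coe_zero, h1, h2]
  smul_mem' := by
    rintro c w ⟨φ, hφ, h⟩
    refine ⟨c • φ, Submodule.smul_mem _ c hφ, ?_⟩
    filter_upwards [Lp.coeFn_smul c (w : L2), fracInt_smul (β := β) (θ := θ) c φ, h]
      with x h1 h2 h3
    rw [Submodule.coe_smul, h1, h2, Pi.smul_apply, Pi.smul_apply, h3]

/-! ### The projection and the two affine functions -/

/-- `P : H¹(0, 1) → H¹₀(0, 1)` is the `H¹`-projection:
`(D P w, D v)_{L²(0,1)} = (D w, D v)_{L²(0,1)}` for all `w ∈ H¹(0, 1)` and `v ∈ H¹₀(0, 1)`. -/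
def IsH1Projection (P : H1 → H10) : Prop :=
  ∀ (w : H1) (v : H10), inner ℝ (D (P w : H1)) (D (v : H1)) = inner ℝ (D w) (D (v : H1))

theorem memLp_of_continuous {f : ℝ → ℝ} (hf : Continuous f) : MemLp f 2 vol01 := by
  obtain ⟨C, hC⟩ := (isCompact_Icc (a := (0 : ℝ)) (b := 1)).exists_bound_of_continuousOn
    hf.continuousOn
  refine MemLp.of_bound hf.aestronglyMeasurable C ?_
  filter_upwards [ae_restrict_mem measurableSet_Ioo] with x hx
  exact hC x (Ioo_subset_Icc_self hx)

/-- The function `w_l^c(x) = 1 - x` on `(0, 1)`. -/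
noncomputable def wl : L2 := (memLp_of_continuous (f := fun x => 1 - x) (by fun_prop)).toLp _

/-- The function `w_r^c(x) = x` on `(0, 1)`. -/
noncomputable def wr : L2 := (memLp_of_continuous (f := fun x => x) (by fun_prop)).toLp _

end FracDiff

/-!
For a test function `φ`, let `a` and `b` be the derivatives of its left and right fractional
integrals of order `β`. On the Fourier side `a` and `b` are `φ` multiplied by symbols of modulus
`|2πω| ^ (1 - β)` whose arguments differ by `β π < π / 2`, and the product `a b` is supported in
`[0, 1]`, so that `⟨a, b⟩ = cos (β π) ‖|2πω| ^ (1 - β) φ̂‖²` in `L²(0, 1)`. Hence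
`‖θ a + (1 - θ) b‖` controls the `H^{1-β}`-norm of `φ`, uniformly in `θ ∈ [0, 1]`: the operator
`φ ↦ (I^β_θ φ)'` is injective with closed range in `L²(0, 1)`.

Its range and the constants together span `L²(0, 1)`: the symbol of `⟨(I^β_θ φ)', φ'⟩` has positive
real part, so that a function of mean zero which is orthogonal to the range vanishes. The range
itself is not all of `L²(0, 1)`: for `θ = 1` it is orthogonal to `(1 - x) ^ (-β)`, as the right
fractional integral of this function is constant, and by the method of continuity surjectivity for
one `θ` would give it for all. So `L²(0, 1)` is the direct sum of the range and the constants.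

The derivative maps `H¹₀(0, 1)` isomorphically onto the functions of mean zero and `P` amounts to
subtracting the mean of the derivative, which turns this decomposition into the theorem.
-/

namespace FracDiff

open scoped Convolution ComplexConjugate

local notation:67 K:67 " ⋆ᵣ " f:66 => convolution K f (ContinuousLinearMap.mul ℝ ℝ) volume

/-! ### The Laplace transform of a power -/

theorem integrableOn_rpow_mul_exp {β r : ℝ} (hβ : 0 < β) (hr : 0 < r) :
    IntegrableOn (fun t : ℝ => t ^ (β - 1) * Real.exp (-(r * t))) (Ioi 0) := by
  simpa using integrableOn_rpow_mul_exp_neg_mul_rpow (p := 1) (s := β - 1) (b := r)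
    (by linarith) one_pos hr

/-- The measure `t ^ (β - 1) dt` on `(0, ∞)`. Viewing the Laplace transform of `t ^ (β - 1)` as
the complex moment generating function of this measure gives its analyticity for free. -/
noncomputable def powMeasure (β : ℝ) : Measure ℝ :=
  (volume.restrict (Ioi (0 : ℝ))).withDensity fun t => ENNReal.ofReal (t ^ (β - 1))

section

variable {β : ℝ} {E : Type*} [NormedAddCommGroup E] [NormedSpace ℝ E]

theorem integrable_powMeasure_iff {g : ℝ → E} :
    Integrable g (powMeasure β) ↔ IntegrableOn (fun t : ℝ => (t ^ (β - 1)) • g t) (Ioi 0) := by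
  rw [powMeasure, integrable_withDensity_iff_integrable_smul' (by fun_prop) (by simp)]
  refine integrable_congr ?_
  filter_upwards [ae_restrict_mem measurableSet_Ioi] with t ht
  rw [ENNReal.toReal_ofReal (Real.rpow_nonneg (le_of_lt ht) _)]

theorem integral_powMeasure (g : ℝ → E) :
    ∫ t, g t ∂(powMeasure β) = ∫ t in Ioi (0 : ℝ), (t ^ (β - 1)) • g t := by
  rw [powMeasure, integral_withDensity_eq_integral_toReal_smul (by fun_prop) (by simp)]
  refine setIntegral_congr_fun measurableSet_Ioi fun t ht => ?_
  rw [ENNReal.toReal_ofReal (Real.rpow_nonneg (le_of_lt ht) _)]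

end

theorem mem_interior_integrableExpSet_powMeasure {β r : ℝ} (hβ : 0 < β) (hr : r < 0) :
    r ∈ interior (ProbabilityTheory.integrableExpSet id (powMeasure β)) := by
  refine mem_interior.2 ⟨Iio 0, fun t ht => ?_, isOpen_Iio, hr⟩
  have h := integrableOn_rpow_mul_exp hβ (neg_pos.2 ht)
  simpa [ProbabilityTheory.integrableExpSet, integrable_powMeasure_iff] using h

theorem complexMGF_powMeasure_ofReal {β r : ℝ} (hβ : 0 < β) (hr : r < 0) :
    ProbabilityTheory.complexMGF id (powMeasure β) r
      = Real.Gamma β * (-(r : ℂ)) ^ (-(β : ℂ)) := by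
  have h := Complex.integral_cpow_mul_exp_neg_mul_Ioi (a := β) (by simpa using hβ) (neg_pos.2 hr)
  have harg : ((-r : ℝ) : ℂ).arg ≠ Real.pi := by
    rw [Complex.arg_ofReal_of_nonneg (neg_pos.2 hr).le]
    exact Real.pi_pos.ne
  rw [one_div, Complex.inv_cpow _ _ harg, ← Complex.cpow_neg, Complex.Gamma_ofReal] at h
  rw [ProbabilityTheory.complexMGF, integral_powMeasure, mul_comm, ← Complex.ofReal_neg, ← h]
  refine setIntegral_congr_fun measurableSet_Ioi fun t ht => ?_
  simp only [id, Complex.real_smul]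
  rw [Complex.ofReal_cpow (le_of_lt ht)]
  push_cast
  ring_nf

theorem tendsto_ofReal_nhdsNE (x : ℝ) :
    Tendsto ((↑) : ℝ → ℂ) (𝓝[≠] x) (𝓝[≠] (x : ℂ)) :=
  tendsto_nhdsWithin_iff.2 ⟨Complex.continuous_ofReal.continuousAt.tendsto.mono_left
    nhdsWithin_le_nhds, eventually_mem_nhdsWithin.mono fun _ h => by simpa using h⟩

theorem complexMGF_powMeasure {β : ℝ} (hβ : 0 < β) {z : ℂ} (hz : z.re < 0) :
    ProbabilityTheory.complexMGF id (powMeasure β) z = Real.Gamma β * (-z) ^ (-(β : ℂ)) := by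
  have hmgf : AnalyticOnNhd ℂ (ProbabilityTheory.complexMGF id (powMeasure β)) {z | z.re < 0} :=
    ProbabilityTheory.analyticOnNhd_complexMGF.mono fun _ hz =>
      mem_interior_integrableExpSet_powMeasure hβ hz
  have hpow : AnalyticOnNhd ℂ (fun z : ℂ => Real.Gamma β * (-z) ^ (-(β : ℂ))) {z | z.re < 0} := by
    refine DifferentiableOn.analyticOnNhd (fun z hz => ?_)
      (isOpen_lt Complex.continuous_re continuous_const)
    have hslit : -z ∈ Complex.slitPlane := Or.inl (by simpa using hz)
    exact (DifferentiableAt.const_mul (DifferentiableAt.cpow_const (by fun_prop) hslit)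
      _).differentiableWithinAt
  have hreal : ∃ᶠ w in 𝓝[≠] ((-1 : ℝ) : ℂ),
      ProbabilityTheory.complexMGF id (powMeasure β) w = Real.Gamma β * (-w) ^ (-(β : ℂ)) := by
    refine (tendsto_ofReal_nhdsNE (-1)).frequently (Eventually.frequently ?_)
    filter_upwards [nhdsWithin_le_nhds (Iio_mem_nhds (by norm_num : (-1 : ℝ) < 0))] with r hr
    exact complexMGF_powMeasure_ofReal hβ hr
  exact hmgf.eqOn_of_preconnected_of_frequently_eq hpow
    (convex_halfSpace_re_lt 0).isPreconnected (by simp) hreal hz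

theorem integral_rpow_mul_cexp {β : ℝ} (hβ : 0 < β) {z : ℂ} (hz : 0 < z.re) :
    ∫ t in Ioi (0 : ℝ), ((t ^ (β - 1) : ℝ) : ℂ) * Complex.exp (-(z * t))
      = Real.Gamma β * z ^ (-(β : ℂ)) := by
  have h := complexMGF_powMeasure hβ (z := -z) (by simpa using hz)
  rw [neg_neg, ProbabilityTheory.complexMGF, integral_powMeasure] at h
  simpa using h

theorem cos_mul_norm_rpow_neg_le_re_cpow {z : ℂ} (hz : 0 < z.re) {s : ℝ} (hs0 : 0 ≤ s)
    (hs2 : s ≤ 2) : Real.cos (s * (Real.pi / 2)) * ‖z‖ ^ (-s) ≤ (z ^ (-(s : ℂ))).re := by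
  have harg : |z.arg| ≤ Real.pi / 2 := (Complex.abs_arg_lt_pi_div_two_iff.2 (Or.inl hz)).le
  rw [← Complex.ofReal_neg, Complex.cpow_ofReal_re, mul_comm]
  refine mul_le_mul_of_nonneg_left ?_ (Real.rpow_nonneg (norm_nonneg _) _)
  rw [← Real.cos_abs (z.arg * -s), abs_mul, abs_neg, abs_of_nonneg hs0, mul_comm]
  refine Real.cos_le_cos_of_nonneg_of_le_pi (by positivity) ?_ (by gcongr)
  nlinarith [Real.pi_pos]

/-! ### The Fourier transform of a real function -/

/-- The Fourier transform of a real function. -/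
noncomputable def fourierOfReal (f : ℝ → ℝ) : ℝ → ℂ := 𝓕 fun x => (f x : ℂ)

section

variable {K K' f g : ℝ → ℝ}

theorem norm_fourierOfReal_le (f : ℝ → ℝ) (ω : ℝ) : ‖fourierOfReal f ω‖ ≤ ∫ x, |f x| :=
  (VectorFourier.norm_fourierIntegral_le_integral_norm Real.fourierChar volume (innerₗ ℝ)
    (fun x => (f x : ℂ)) ω).trans_eq (by simp)

theorem continuous_fourierOfReal (hf : Integrable f) : Continuous (fourierOfReal f) :=
  VectorFourier.fourierIntegral_continuous Real.continuous_fourierChar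
    (by exact continuous_inner) hf.ofReal

theorem fourierOfReal_sub (hf : Integrable f) (hg : Integrable g) (ω : ℝ) :
    fourierOfReal (f - g) ω = fourierOfReal f ω - fourierOfReal g ω := by
  simp only [fourierOfReal]
  rw [Real.fourier_eq, Real.fourier_eq, Real.fourier_eq,
    ← integral_sub ((Real.fourierIntegral_convergent_iff ω).2 hf.ofReal)
      ((Real.fourierIntegral_convergent_iff ω).2 hg.ofReal)]
  simp [smul_sub]

theorem fourierOfReal_comp_neg (f : ℝ → ℝ) (ω : ℝ) :
    fourierOfReal (fun t => f (-t)) ω = conj (fourierOfReal f ω) := by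
  rw [fourierOfReal, fourierOfReal, Real.fourier_real_eq_integral_exp_smul,
    Real.fourier_real_eq_integral_exp_smul, ← integral_conj, ← integral_neg_eq_self]
  congr 1
  ext t
  simp [← Complex.exp_conj, Complex.conj_ofNat]

theorem integrable_fourierOfReal_mul (hf : Integrable f) {G : ℝ → ℂ} (hG : Integrable G) :
    Integrable fun ω => fourierOfReal f ω * G ω :=
  hG.bdd_mul (continuous_fourierOfReal hf).aestronglyMeasurable
    (ae_of_all _ (norm_fourierOfReal_le f))

theorem integrable_norm_fourierOfReal_sq (hf : Integrable (fourierOfReal f)) :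
    Integrable fun ω => ‖fourierOfReal f ω‖ ^ 2 := by
  simp only [sq]
  exact hf.norm.mul_bdd hf.norm.aestronglyMeasurable
    (ae_of_all _ fun ω => by simpa only [norm_norm] using norm_fourierOfReal_le f ω)

theorem fourierOfReal_convolution (hK : Integrable K) (hf : Integrable f) (ω : ℝ) :
    fourierOfReal (K ⋆ᵣ f) ω = fourierOfReal K ω * fourierOfReal f ω := by
  have hcast (x : ℝ) : (((K ⋆ᵣ f) x : ℝ) : ℂ)
      = ((fun t => (K t : ℂ)) ⋆[ContinuousLinearMap.mul ℂ ℂ] fun t => (f t : ℂ)) x := by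
    simp only [convolution_def, ContinuousLinearMap.mul_apply']
    rw [← integral_complex_ofReal]
    simp
  simp only [fourierOfReal, hcast]
  exact Real.fourier_mul_convolution_eq hK.ofReal hf.ofReal ω

/-! ### Parseval's identity -/

theorem integral_mul_conj_eq_integral_fourier {F G : ℝ → ℂ} (hF : Integrable F)
    (hG : Integrable G) (hGc : Continuous G) (hG' : Integrable (𝓕 G)) :
    ∫ x, F x * conj (G x) = ∫ ω, 𝓕 F ω * conj (𝓕 G ω) := by
  have hinv : VectorFourier.fourierIntegral Real.fourierChar volume (-(innerₗ ℝ).flip) (𝓕 G)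
      = G := by
    conv_rhs => rw [← hGc.fourierInv_fourier_eq hG hG']
    ext x
    rw [Real.fourierInv_eq]
    simp [VectorFourier.fourierIntegral]
  have h := VectorFourier.integral_sesq_fourierIntegral_eq_neg_flip (innerSL ℂ)
    (L := innerₗ ℝ) Real.continuous_fourierChar continuous_inner hF hG'
  rw [hinv] at h
  have hconj := congrArg conj h
  rw [← integral_conj, ← integral_conj] at hconj
  simp only [innerSL_apply_apply, RCLike.inner_apply, map_mul, Complex.conj_conj,
    mul_comm (conj _)] at hconj
  exact hconj.symm

theorem integral_mul_eq_integral_re_fourierOfReal (hf : Integrable f) (hg : Integrable g)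
    (hgc : Continuous g) (hg' : Integrable (fourierOfReal g)) :
    ∫ x, f x * g x = ∫ ω, (fourierOfReal f ω * conj (fourierOfReal g ω)).re := by
  have hconj : Integrable fun ω => conj (fourierOfReal g ω) :=
    Complex.conjLIE.integrable_comp_iff.2 hg'
  calc ∫ x, f x * g x = (∫ x, (f x : ℂ) * conj (g x : ℂ)).re := by
        rw [← Complex.ofReal_re (∫ x, f x * g x), ← integral_complex_ofReal]
        simp
    _ = (∫ ω, fourierOfReal f ω * conj (fourierOfReal g ω)).re :=
        congrArg Complex.re (integral_mul_conj_eq_integral_fourier (F := fun x => (f x : ℂ))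
          (G := fun x => (g x : ℂ)) hf.ofReal hg.ofReal (by fun_prop) hg')
    _ = _ := (integral_re (integrable_fourierOfReal_mul hf hconj)).symm

theorem integral_convolution_mul (hK : Integrable K) (hf : Integrable f) (hfc : Continuous f)
    (hf' : Integrable (fourierOfReal f)) :
    ∫ x, (K ⋆ᵣ f) x * f x = ∫ ω, (fourierOfReal K ω).re * ‖fourierOfReal f ω‖ ^ 2 := by
  rw [integral_mul_eq_integral_re_fourierOfReal (hK.integrable_convolution _ hf) hf hfc hf']
  congr with ω
  rw [fourierOfReal_convolution hK hf, mul_assoc, Complex.mul_conj, Complex.re_mul_ofReal,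
    Complex.normSq_eq_norm_sq]

theorem integral_convolution_mul_convolution (hK : Integrable K) (hK' : Integrable K')
    (hf : Integrable f) (hfc : Continuous f) (hfs : HasCompactSupport f)
    (hf' : Integrable (fourierOfReal f)) :
    ∫ x, (K ⋆ᵣ f) x * (K' ⋆ᵣ f) x
      = ∫ ω, (fourierOfReal K ω * conj (fourierOfReal K' ω)).re * ‖fourierOfReal f ω‖ ^ 2 := by
  have hF : fourierOfReal (K' ⋆ᵣ f) = fun ω => fourierOfReal K' ω * fourierOfReal f ω :=
    funext (fourierOfReal_convolution hK' hf)
  rw [integral_mul_eq_integral_re_fourierOfReal (hK.integrable_convolution _ hf)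
    (hK'.integrable_convolution _ hf)
    (hfs.continuous_convolution_right _ hK'.locallyIntegrable hfc)
    (hF ▸ integrable_fourierOfReal_mul hK' hf')]
  congr with ω
  rw [fourierOfReal_convolution hK hf, fourierOfReal_convolution hK' hf, map_mul,
    mul_mul_mul_comm, Complex.mul_conj (fourierOfReal f ω), Complex.re_mul_ofReal,
    Complex.normSq_eq_norm_sq]

theorem integral_convolution_comp_neg_mul (hK : Integrable K) (hf : Integrable f)
    (hfc : Continuous f) (hf' : Integrable (fourierOfReal f)) :
    ∫ x, ((fun t => K (-t)) ⋆ᵣ f) x * f x = ∫ x, (K ⋆ᵣ f) x * f x := by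
  simp only [integral_convolution_mul hK hf hfc hf',
    integral_convolution_mul hK.comp_neg hf hfc hf', fourierOfReal_comp_neg, Complex.conj_re]

theorem integral_convolution_comp_neg_sq (hK : Integrable K) (hf : Integrable f)
    (hfc : Continuous f) (hfs : HasCompactSupport f) (hf' : Integrable (fourierOfReal f)) :
    ∫ x, ((fun t => K (-t)) ⋆ᵣ f) x * ((fun t => K (-t)) ⋆ᵣ f) x
      = ∫ x, (K ⋆ᵣ f) x * (K ⋆ᵣ f) x := by
  simp only [integral_convolution_mul_convolution hK hK hf hfc hfs hf',
    integral_convolution_mul_convolution hK.comp_neg hK.comp_neg hf hfc hfs hf',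
    fourierOfReal_comp_neg, Complex.conj_conj, mul_comm (conj _)]

end

/-! ### Kernels of fractional integration -/

/-- The kernel `t ^ (β - 1) / Γ(β)` on `(0, 1)`: on `(0, 1)` the left fractional integral of order
`β` is the convolution with this kernel, and the right one is the convolution with its
reflection. -/
noncomputable def unitKernel (β : ℝ) : ℝ → ℝ :=
  (Ioo (0 : ℝ) 1).indicator fun t => t ^ (β - 1) / Real.Gamma β

/-- The kernel `t ^ (β - 1) e ^ (-ε t) / Γ(β)` on `(0, ∞)`, an integrable substitute for
`t ^ (β - 1) / Γ(β)` whose Fourier transform is explicit. -/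
noncomputable def dampedKernel (β ε : ℝ) : ℝ → ℝ :=
  (Ioi (0 : ℝ)).indicator fun t => t ^ (β - 1) * Real.exp (-(ε * t)) / Real.Gamma β

theorem dampedKernel_of_nonpos (β ε : ℝ) {t : ℝ} (ht : t ≤ 0) : dampedKernel β ε t = 0 :=
  indicator_of_notMem (by simpa using ht) _

theorem integrable_unitKernel {β : ℝ} (hβ : 0 < β) : Integrable (unitKernel β) :=
  (integrable_indicator_iff measurableSet_Ioo).2
    (((intervalIntegral.integrableOn_Ioo_rpow_iff one_pos).2 (by linarith)).div_const _)

theorem integrable_dampedKernel {β ε : ℝ} (hβ : 0 < β) (hε : 0 < ε) :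
    Integrable (dampedKernel β ε) :=
  (integrable_indicator_iff measurableSet_Ioi).2 ((integrableOn_rpow_mul_exp hβ hε).div_const _)

theorem norm_dampedKernel_le {β ε : ℝ} (hβ : 0 < β) (hε : 0 < ε) {t : ℝ} (ht : t < 1) :
    ‖dampedKernel β ε t‖ ≤ ‖unitKernel β t‖ := by
  rcases le_or_gt t 0 with h | h
  · rw [dampedKernel_of_nonpos β ε h, norm_zero]
    positivity
  · have hpow := Real.rpow_pos_of_pos h (β - 1)
    rw [dampedKernel, unitKernel, indicator_of_mem (mem_Ioi.2 h),
      indicator_of_mem (show t ∈ Ioo (0 : ℝ) 1 from ⟨h, ht⟩),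
      Real.norm_of_nonneg (by positivity), Real.norm_of_nonneg (by positivity)]
    gcongr
    exact mul_le_of_le_one_right hpow.le (Real.exp_le_one_iff.2 (by nlinarith))

theorem tendsto_dampedKernel (β : ℝ) {t : ℝ} (ht : t < 1) {e : ℕ → ℝ}
    (he : Tendsto e atTop (𝓝 0)) :
    Tendsto (fun n => dampedKernel β (e n) t) atTop (𝓝 (unitKernel β t)) := by
  rcases le_or_gt t 0 with h | h
  · have h' : t ∉ Ioo (0 : ℝ) 1 := fun hmem => h.not_gt hmem.1
    simp only [dampedKernel_of_nonpos β _ h, unitKernel, indicator_of_notMem h']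
    exact tendsto_const_nhds
  · simp only [dampedKernel, unitKernel, indicator_of_mem (mem_Ioi.2 h),
      indicator_of_mem (show t ∈ Ioo (0 : ℝ) 1 from ⟨h, ht⟩)]
    have hlim : Tendsto (fun n => t ^ (β - 1) * Real.exp (-(e n * t)) / Real.Gamma β) atTop
        (𝓝 (t ^ (β - 1) * Real.exp (-(0 * t)) / Real.Gamma β)) :=
      (((Real.continuous_exp.tendsto _).comp (he.mul_const t).neg).const_mul _).div_const _
    simpa using hlim

/-- The point `ε + 2πiω`, at which the Laplace transform is the Fourier transform at `ω` of the
function damped by `e ^ (-ε t)`. -/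
noncomputable def laplacePoint (ε ω : ℝ) : ℂ := (ε : ℂ) + 2 * Real.pi * ω * Complex.I

@[simp] theorem laplacePoint_re (ε ω : ℝ) : (laplacePoint ε ω).re = ε := by
  simp [laplacePoint]

theorem le_norm_laplacePoint (ε ω : ℝ) : 2 * Real.pi * |ω| ≤ ‖laplacePoint ε ω‖ := by
  have h := Complex.abs_im_le_norm (laplacePoint ε ω)
  simpa [laplacePoint, abs_mul, abs_of_pos Real.pi_pos] using h

theorem fourierOfReal_dampedKernel {β ε : ℝ} (hβ : 0 < β) (hε : 0 < ε) (ω : ℝ) :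
    fourierOfReal (dampedKernel β ε) ω = laplacePoint ε ω ^ (-(β : ℂ)) := by
  have hlap := integral_rpow_mul_cexp hβ (z := laplacePoint ε ω) (by simpa using hε)
  have hΓ : (Real.Gamma β : ℂ) ≠ 0 := by exact_mod_cast (Real.Gamma_pos_of_pos hβ).ne'
  rw [fourierOfReal, Real.fourier_real_eq_integral_exp_smul, ← mul_right_inj' hΓ, ← hlap,
    ← integral_const_mul, ← integral_indicator measurableSet_Ioi]
  congr 1
  ext t
  by_cases h : t ∈ Ioi (0 : ℝ)
  · simp only [dampedKernel, indicator_of_mem h, smul_eq_mul, laplacePoint]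
    push_cast
    field_simp
    rw [mul_assoc, mul_comm, mul_assoc, ← Complex.exp_add]
    congr 2
    ring
  · simp [dampedKernel, indicator_of_notMem h]

/-! ### Test functions -/

theorem Test.eq_zero_of_notMem (φ : Test) {x : ℝ} (hx : x ∉ Ioo (0 : ℝ) 1) : φ x = 0 := by
  by_contra hne
  exact hx (φ.tsupport_subset (subset_tsupport _ hne))

theorem Test.differentiable (φ : Test) : Differentiable ℝ φ :=
  φ.contDiff.differentiable (by simp)

theorem Test.exists_bound (φ : Test) : ∃ C, 0 ≤ C ∧ ∀ x, ‖φ x‖ ≤ C := by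
  obtain ⟨C, hC⟩ := φ.continuous.bounded_above_of_compact_support φ.hasCompactSupport
  exact ⟨C, (norm_nonneg _).trans (hC 0), hC⟩

theorem Test.memLp (φ : Test) (p : ℝ≥0∞) : MemLp φ p :=
  φ.continuous.memLp_of_hasCompactSupport φ.hasCompactSupport

theorem Test.integrable_sq (φ : Test) : Integrable fun x => φ x ^ 2 :=
  (φ.memLp 2).integrable_sq

theorem Test.setIntegral_eq_integral (φ : Test) {F : ℝ → ℝ} (hF : ∀ x, φ x = 0 → F x = 0) :
    ∫ x in Ioo (0 : ℝ) 1, F x = ∫ x, F x :=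
  setIntegral_eq_integral_of_forall_compl_eq_zero fun x hx => hF x (φ.eq_zero_of_notMem hx)

/-- The derivative of a test function. -/
noncomputable def testDeriv (φ : Test) : Test where
  toFun := deriv φ
  contDiff' := φ.contDiff.deriv'
  hasCompactSupport' := φ.hasCompactSupport.deriv
  tsupport_subset' := tsupport_deriv_subset.trans φ.tsupport_subset

@[simp] theorem coe_testDeriv (φ : Test) : ⇑(testDeriv φ) = deriv φ := rfl

theorem testDeriv_add (φ ψ : Test) : testDeriv (φ + ψ) = testDeriv φ + testDeriv ψ := by
  ext x
  simp only [coe_testDeriv, FunLike.coe_add]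
  exact deriv_add (φ.differentiable x) (ψ.differentiable x)

theorem testDeriv_smul (c : ℝ) (φ : Test) : testDeriv (c • φ) = c • testDeriv φ := by
  ext x
  simp only [coe_testDeriv, FunLike.coe_smul]
  exact deriv_const_smul c (φ.differentiable x)

/-- A test function as a Schwartz function. -/
noncomputable def Test.toSchwartz (φ : Test) : SchwartzMap ℝ ℂ :=
  HasCompactSupport.toSchwartzMap (f := fun x => (φ x : ℂ))
    (φ.hasCompactSupport.comp_left (g := fun r : ℝ => (r : ℂ)) Complex.ofReal_zero)
    (Complex.ofRealCLM.contDiff.comp φ.contDiff)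

theorem coe_fourier_toSchwartz (φ : Test) :
    ⇑(𝓕 φ.toSchwartz : SchwartzMap ℝ ℂ) = fourierOfReal φ := rfl

theorem Test.integrable_fourierOfReal (φ : Test) : Integrable (fourierOfReal φ) :=
  (𝓕 φ.toSchwartz : SchwartzMap ℝ ℂ).integrable

theorem Test.integral_norm_fourierOfReal_sq (φ : Test) :
    ∫ ω, ‖fourierOfReal φ ω‖ ^ 2 = ∫ x, φ x ^ 2 := by
  have h := φ.toSchwartz.integral_norm_sq_fourier
  rw [coe_fourier_toSchwartz] at h
  rw [h]
  congr with x
  change ‖(φ x : ℂ)‖ ^ 2 = φ x ^ 2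
  simp

theorem norm_fourierOfReal_testDeriv (φ : Test) (ω : ℝ) :
    ‖fourierOfReal (testDeriv φ) ω‖ = 2 * Real.pi * |ω| * ‖fourierOfReal φ ω‖ := by
  have hd : deriv (fun x => (φ x : ℂ)) = fun x => ((deriv φ x : ℝ) : ℂ) := by
    ext x
    exact (φ.differentiable x).hasDerivAt.ofReal_comp.deriv
  have h := Real.fourier_deriv (f := fun x => (φ x : ℂ)) (test_integrable' φ).ofReal
    (fun x => (φ.differentiable x).hasDerivAt.ofReal_comp.differentiableAt)
    (by rw [hd]; exact (test_integrable' (testDeriv φ)).ofReal)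
  rw [hd] at h
  rw [fourierOfReal, coe_testDeriv, congrFun h ω]
  simp [fourierOfReal, abs_of_pos Real.pi_pos]

instance : IsProbabilityMeasure vol01 := ⟨by simp⟩

theorem sq_integral_Ioo_le {f : ℝ → ℝ} (hf : MemLp f 2 vol01) :
    (∫ x in Ioo (0 : ℝ) 1, f x) ^ 2 ≤ ∫ x in Ioo (0 : ℝ) 1, f x ^ 2 := by
  have h := ProbabilityTheory.variance_nonneg f vol01
  rw [ProbabilityTheory.variance_eq_sub hf] at h
  exact sub_nonneg.1 h

theorem Test.norm_fourierOfReal_sq_le (φ : Test) (ω : ℝ) :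
    ‖fourierOfReal φ ω‖ ^ 2 ≤ ∫ x, φ x ^ 2 := by
  have habs : MemLp (fun x => |φ x|) 2 vol01 :=
    (φ.memLp 2).abs.mono_measure Measure.restrict_le_self
  calc ‖fourierOfReal φ ω‖ ^ 2 ≤ (∫ x, |φ x|) ^ 2 :=
        pow_le_pow_left₀ (norm_nonneg _) (norm_fourierOfReal_le φ ω) 2
    _ = (∫ x in Ioo (0 : ℝ) 1, |φ x|) ^ 2 := by
        rw [φ.setIntegral_eq_integral fun x hx => by simp [hx]]
    _ ≤ ∫ x in Ioo (0 : ℝ) 1, |φ x| ^ 2 := sq_integral_Ioo_le habs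
    _ = ∫ x, φ x ^ 2 := by
        simp only [sq_abs]
        exact φ.setIntegral_eq_integral fun x hx => by simp [hx]

/-! ### Homogeneous Sobolev seminorms of test functions -/

/-- The square of the homogeneous Sobolev seminorm of order `s` of a test function. -/
noncomputable def energy (s : ℝ) (φ : Test) : ℝ :=
  ∫ ω, |ω| ^ (2 * s) * ‖fourierOfReal φ ω‖ ^ 2

theorem energy_nonneg (s : ℝ) (φ : Test) : 0 ≤ energy s φ :=
  integral_nonneg fun _ => by positivity

theorem Test.integrable_pow_mul_norm_fourierOfReal_sq (φ : Test) (n : ℕ) :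
    Integrable fun ω => |ω| ^ n * ‖fourierOfReal φ ω‖ ^ 2 := by
  have hdecay : Integrable fun ω => ‖ω‖ ^ n * ‖fourierOfReal φ ω‖ :=
    (𝓕 φ.toSchwartz : SchwartzMap ℝ ℂ).integrable_pow_mul volume n
  have hcont := continuous_fourierOfReal (test_integrable' φ)
  refine (hdecay.mul_bdd hcont.norm.aestronglyMeasurable (c := ∫ x, |φ x|)
    (ae_of_all _ fun ω => ?_)).congr (ae_of_all _ fun ω => ?_)
  · simpa only [norm_norm] using norm_fourierOfReal_le φ ω
  · simp only [Real.norm_eq_abs]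
    ring

theorem abs_rpow_le_one_add_pow {r : ℝ} {n : ℕ} (hr : 0 ≤ r) (hrn : r ≤ n) (ω : ℝ) :
    |ω| ^ r ≤ 1 + |ω| ^ n := by
  rcases le_total |ω| 1 with h | h
  · exact (Real.rpow_le_one (abs_nonneg ω) h hr).trans (by simp)
  · rw [← Real.rpow_natCast]
    exact (Real.rpow_le_rpow_of_exponent_le h hrn).trans (by simp)

theorem integrable_norm_fourierOfReal_sq_add_pow_mul (φ : Test) (n : ℕ) :
    Integrable fun ω => ‖fourierOfReal φ ω‖ ^ 2 + |ω| ^ n * ‖fourierOfReal φ ω‖ ^ 2 :=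
  (integrable_norm_fourierOfReal_sq φ.integrable_fourierOfReal).add
    (φ.integrable_pow_mul_norm_fourierOfReal_sq n)

theorem abs_rpow_mul_norm_fourierOfReal_sq_le (φ : Test) {r : ℝ} {n : ℕ} (hr : 0 ≤ r)
    (hrn : r ≤ n) (ω : ℝ) : |ω| ^ r * ‖fourierOfReal φ ω‖ ^ 2
      ≤ ‖fourierOfReal φ ω‖ ^ 2 + |ω| ^ n * ‖fourierOfReal φ ω‖ ^ 2 := by
  rw [← one_add_mul]
  exact mul_le_mul_of_nonneg_right (abs_rpow_le_one_add_pow hr hrn ω) (sq_nonneg _)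

theorem integrable_energy {s : ℝ} (hs : 0 ≤ s) (φ : Test) :
    Integrable fun ω => |ω| ^ (2 * s) * ‖fourierOfReal φ ω‖ ^ 2 := by
  obtain ⟨n, hn⟩ := exists_nat_ge (2 * s)
  have hmeas := (continuous_fourierOfReal (test_integrable' φ)).measurable
  refine (integrable_norm_fourierOfReal_sq_add_pow_mul φ n).mono'
    (Measurable.aestronglyMeasurable (by fun_prop)) (ae_of_all _ fun ω => ?_)
  rw [Real.norm_of_nonneg (by positivity)]
  exact abs_rpow_mul_norm_fourierOfReal_sq_le φ (by positivity) hn ω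

theorem energy_le {s : ℝ} (hs0 : 0 ≤ s) (hs1 : s ≤ 1) (φ : Test) :
    energy s φ ≤ (∫ x, φ x ^ 2) + energy 1 φ := by
  have hone : energy 1 φ = ∫ ω, |ω| ^ 2 * ‖fourierOfReal φ ω‖ ^ 2 := by
    simp only [energy, mul_one, Real.rpow_two]
  rw [hone, ← φ.integral_norm_fourierOfReal_sq,
    ← integral_add (integrable_norm_fourierOfReal_sq φ.integrable_fourierOfReal)
      (φ.integrable_pow_mul_norm_fourierOfReal_sq 2)]
  exact integral_mono (integrable_energy hs0 φ) (integrable_norm_fourierOfReal_sq_add_pow_mul φ 2)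
    fun ω => abs_rpow_mul_norm_fourierOfReal_sq_le φ (by positivity)
      (by push_cast; linarith) ω

theorem integral_testDeriv_sq (φ : Test) :
    ∫ x, testDeriv φ x ^ 2 = (2 * Real.pi) ^ 2 * energy 1 φ := by
  rw [← Test.integral_norm_fourierOfReal_sq, energy, ← integral_const_mul]
  congr with ω
  rw [norm_fourierOfReal_testDeriv, mul_one, Real.rpow_two]
  ring

/-- The low frequencies carry at most half of the `L²` norm, because the Fourier transform of `φ`
is bounded by the `L²` norm of `φ`. -/
theorem integral_sq_le_energy {s : ℝ} (hs : 0 ≤ s) (φ : Test) :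
    ∫ x, φ x ^ 2 ≤ 2 * 4 ^ (2 * s) * energy s φ := by
  set A := ∫ x, φ x ^ 2
  have hlow : Integrable ((Icc (-(1 / 4) : ℝ) (1 / 4)).indicator fun _ => A) :=
    (integrable_indicator_iff measurableSet_Icc).2 (by simp)
  have hhigh := (integrable_energy hs φ).const_mul ((4 : ℝ) ^ (2 * s))
  have hpoint (ω : ℝ) : ‖fourierOfReal φ ω‖ ^ 2
      ≤ (Icc (-(1 / 4) : ℝ) (1 / 4)).indicator (fun _ => A) ω
        + 4 ^ (2 * s) * (|ω| ^ (2 * s) * ‖fourierOfReal φ ω‖ ^ 2) := by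
    by_cases h : ω ∈ Icc (-(1 / 4) : ℝ) (1 / 4)
    · rw [indicator_of_mem h]
      exact (φ.norm_fourierOfReal_sq_le ω).trans (le_add_of_nonneg_right (by positivity))
    · have hω : ¬ |ω| ≤ 1 / 4 := fun h' => h (abs_le.1 h')
      rw [indicator_of_notMem h, zero_add, ← mul_assoc,
        ← Real.mul_rpow (by norm_num) (abs_nonneg _)]
      exact le_mul_of_one_le_left (sq_nonneg _) (Real.one_le_rpow (by linarith) (by linarith))
  have hA : A ≤ A / 2 + 4 ^ (2 * s) * energy s φ := calc
    A = ∫ ω, ‖fourierOfReal φ ω‖ ^ 2 := φ.integral_norm_fourierOfReal_sq.symm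
    _ ≤ ∫ ω, ((Icc (-(1 / 4) : ℝ) (1 / 4)).indicator (fun _ => A) ω
          + 4 ^ (2 * s) * (|ω| ^ (2 * s) * ‖fourierOfReal φ ω‖ ^ 2)) :=
        integral_mono (integrable_norm_fourierOfReal_sq φ.integrable_fourierOfReal)
          (hlow.add hhigh) hpoint
    _ = A / 2 + 4 ^ (2 * s) * energy s φ := by
        rw [integral_add hlow hhigh, integral_indicator measurableSet_Icc, integral_const_mul,
          energy]
        simp
        ring
  linarith

theorem sobolevSeminorm_sq {s : ℝ} (hs : 0 ≤ s) (φ : Test) :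
    sobolevSeminorm s φ ^ 2 = ENNReal.ofReal (energy s φ) := by
  rw [sobolevSeminorm, energy, ofReal_integral_eq_lintegral_ofReal (integrable_energy hs φ)
    (ae_of_all _ fun _ => by positivity), ← ENNReal.rpow_natCast,
    eLpNorm_eq_lintegral_rpow_enorm_toReal (by norm_num) (by norm_num), ← ENNReal.rpow_mul]
  norm_num
  congr with ω
  rw [← enorm_mul, ← ofReal_norm, ← ENNReal.ofReal_pow (norm_nonneg _), norm_mul, mul_pow,
    Complex.norm_real, Real.norm_of_nonneg (by positivity), mul_comm 2 s,
    Real.rpow_mul (abs_nonneg _), Real.rpow_two]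
  rfl

/-! ### Approximation by damped kernels -/

theorem continuous_conv {K : ℝ → ℝ} (hK : Integrable K) (φ : Test) : Continuous (K ⋆ᵣ φ) :=
  φ.hasCompactSupport.continuous_convolution_right _ hK.locallyIntegrable φ.continuous

theorem norm_conv_le {K : ℝ → ℝ} (hK : Integrable K) {g : ℝ → ℝ} {C : ℝ} (hC : ∀ x, ‖g x‖ ≤ C)
    (x : ℝ) : ‖(K ⋆ᵣ g) x‖ ≤ C * ∫ t, ‖K t‖ := by
  rw [convolution_def, ← integral_const_mul]
  refine norm_integral_le_of_norm_le (hK.norm.const_mul C) (ae_of_all _ fun t => ?_)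
  rw [ContinuousLinearMap.mul_apply', norm_mul, mul_comm]
  gcongr
  exact hC _

theorem Test.apply_sub_eq_zero (φ : Test) {x t : ℝ} (hx : x ∈ Ioo (0 : ℝ) 1) (ht : ¬ |t| < 1) :
    φ (x - t) = 0 := by
  refine φ.eq_zero_of_notMem fun h => ht ?_
  rw [abs_lt]
  constructor <;> linarith [h.1, h.2, hx.1, hx.2]

theorem tendsto_setIntegral_Ioo_mul {F G : ℕ → ℝ → ℝ} {F₀ G₀ : ℝ → ℝ} {A B : ℝ}
    (hF : ∀ n, Continuous (F n)) (hG : ∀ n, Continuous (G n))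
    (hA : ∀ n, ∀ x ∈ Ioo (0 : ℝ) 1, ‖F n x‖ ≤ A) (hB : ∀ n, ∀ x ∈ Ioo (0 : ℝ) 1, ‖G n x‖ ≤ B)
    (hF₀ : ∀ x ∈ Ioo (0 : ℝ) 1, Tendsto (F · x) atTop (𝓝 (F₀ x)))
    (hG₀ : ∀ x ∈ Ioo (0 : ℝ) 1, Tendsto (G · x) atTop (𝓝 (G₀ x))) :
    Tendsto (fun n => ∫ x in Ioo (0 : ℝ) 1, F n x * G n x) atTop
      (𝓝 (∫ x in Ioo (0 : ℝ) 1, F₀ x * G₀ x)) := by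
  refine tendsto_integral_of_dominated_convergence (fun _ => A * B)
    (fun n => ((hF n).mul (hG n)).aestronglyMeasurable) (integrable_const _) (fun n => ?_) ?_
  · filter_upwards [ae_restrict_mem measurableSet_Ioo] with x hx
    rw [norm_mul]
    exact mul_le_mul (hA n x hx) (hB n x hx) (norm_nonneg _) ((norm_nonneg _).trans (hA n x hx))
  · filter_upwards [ae_restrict_mem measurableSet_Ioo] with x hx
    exact (hF₀ x hx).mul (hG₀ x hx)

/-- The integrable kernels `Kn` converge to the integrable kernel `K` on `(-1, 1)` and are
dominated by `K` there; only these values enter a convolution with a function on `(0, 1)`, taken on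
`(0, 1)`. -/
structure KernelApprox (Kn : ℕ → ℝ → ℝ) (K : ℝ → ℝ) : Prop where
  integrable_lim : Integrable K
  integrable : ∀ n, Integrable (Kn n)
  norm_le : ∀ n t, |t| < 1 → ‖Kn n t‖ ≤ ‖K t‖
  tendsto : ∀ t, |t| < 1 → Tendsto (fun n => Kn n t) atTop (𝓝 (K t))

namespace KernelApprox

variable {Kn Kn' : ℕ → ℝ → ℝ} {K K' : ℝ → ℝ}

theorem comp_neg (h : KernelApprox Kn K) :
    KernelApprox (fun n t => Kn n (-t)) (fun t => K (-t)) where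
  integrable_lim := h.integrable_lim.comp_neg
  integrable n := (h.integrable n).comp_neg
  norm_le n t ht := h.norm_le n (-t) (by rwa [abs_neg])
  tendsto t ht := h.tendsto (-t) (by rwa [abs_neg])

theorem norm_integrand_le (h : KernelApprox Kn K) {φ : Test} {C : ℝ} (hC : ∀ x, ‖φ x‖ ≤ C)
    {x : ℝ} (hx : x ∈ Ioo (0 : ℝ) 1) (n : ℕ) (t : ℝ) :
    ‖Kn n t * φ (x - t)‖ ≤ C * ‖K t‖ := by
  have hC0 : 0 ≤ C := (norm_nonneg _).trans (hC 0)
  by_cases ht : |t| < 1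
  · rw [norm_mul, mul_comm]
    exact mul_le_mul (hC _) (h.norm_le n t ht) (norm_nonneg _) hC0
  · rw [φ.apply_sub_eq_zero hx ht, mul_zero, norm_zero]
    positivity

theorem norm_conv_le (h : KernelApprox Kn K) {φ : Test} {C : ℝ} (hC : ∀ x, ‖φ x‖ ≤ C)
    {x : ℝ} (hx : x ∈ Ioo (0 : ℝ) 1) (n : ℕ) :
    ‖(Kn n ⋆ᵣ φ) x‖ ≤ C * ∫ t, ‖K t‖ := by
  rw [convolution_def, ← integral_const_mul]
  exact norm_integral_le_of_norm_le (h.integrable_lim.norm.const_mul C)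
    (ae_of_all _ fun t => h.norm_integrand_le hC hx n t)

theorem tendsto_conv (h : KernelApprox Kn K) (φ : Test) {x : ℝ} (hx : x ∈ Ioo (0 : ℝ) 1) :
    Tendsto (fun n => (Kn n ⋆ᵣ φ) x) atTop (𝓝 ((K ⋆ᵣ φ) x)) := by
  obtain ⟨C, -, hC⟩ := φ.exists_bound
  simp only [convolution_def, ContinuousLinearMap.mul_apply']
  refine tendsto_integral_of_dominated_convergence (fun t => C * ‖K t‖)
    (fun n => ?_) (h.integrable_lim.norm.const_mul C)
    (fun n => ae_of_all _ fun t => h.norm_integrand_le hC hx n t) (ae_of_all _ fun t => ?_)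
  · exact (h.integrable n).aestronglyMeasurable.mul
      (φ.continuous.comp (continuous_const.sub continuous_id)).aestronglyMeasurable
  · by_cases ht : |t| < 1
    · exact (h.tendsto t ht).mul_const _
    · simp only [φ.apply_sub_eq_zero hx ht, mul_zero]
      exact tendsto_const_nhds

theorem tendsto_integral_mul (h : KernelApprox Kn K) (h' : KernelApprox Kn' K') (φ : Test) :
    Tendsto (fun n => ∫ x in Ioo (0 : ℝ) 1, (Kn n ⋆ᵣ φ) x * (Kn' n ⋆ᵣ φ) x) atTop
      (𝓝 (∫ x in Ioo (0 : ℝ) 1, (K ⋆ᵣ φ) x * (K' ⋆ᵣ φ) x)) := by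
  obtain ⟨C, -, hC⟩ := φ.exists_bound
  exact tendsto_setIntegral_Ioo_mul (fun n => continuous_conv (h.integrable n) φ)
    (fun n => continuous_conv (h'.integrable n) φ) (fun n x hx => h.norm_conv_le hC hx n)
    (fun n x hx => h'.norm_conv_le hC hx n) (fun x hx => h.tendsto_conv φ hx)
    fun x hx => h'.tendsto_conv φ hx

theorem tendsto_integral_mul_test (h : KernelApprox Kn K) (φ : Test) :
    Tendsto (fun n => ∫ x, (Kn n ⋆ᵣ φ) x * φ x) atTop
      (𝓝 (∫ x in Ioo (0 : ℝ) 1, (K ⋆ᵣ φ) x * φ x)) := by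
  obtain ⟨C, -, hC⟩ := φ.exists_bound
  have hlim := tendsto_setIntegral_Ioo_mul (fun n => continuous_conv (h.integrable n) φ)
    (fun _ => φ.continuous) (fun n x hx => h.norm_conv_le hC hx n) (fun _ x _ => hC x)
    (fun x hx => h.tendsto_conv φ hx) fun _ _ => tendsto_const_nhds
  exact hlim.congr fun n => φ.setIntegral_eq_integral fun x hx => by simp [hx]

end KernelApprox

/-- The damping parameters `1 / (n + 1)` used to approximate the kernel of the fractional
integral. -/
noncomputable def damping (n : ℕ) : ℝ := 1 / ((n : ℝ) + 1)

theorem damping_pos (n : ℕ) : 0 < damping n := Nat.one_div_pos_of_nat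

theorem tendsto_damping : Tendsto damping atTop (𝓝 0) :=
  tendsto_one_div_add_atTop_nhds_zero_nat

theorem kernelApprox_dampedKernel {β : ℝ} (hβ : 0 < β) :
    KernelApprox (fun n => dampedKernel β (damping n)) (unitKernel β) where
  integrable_lim := integrable_unitKernel hβ
  integrable n := integrable_dampedKernel hβ (damping_pos n)
  norm_le n _ ht := norm_dampedKernel_le hβ (damping_pos n) (abs_lt.1 ht).2
  tendsto _ ht := tendsto_dampedKernel β (abs_lt.1 ht).2 tendsto_damping

/-! ### Energy identities -/

/-- The energy of order `1 - a / 2` of a test function, up to a constant, with the frequency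
`2πi ω` replaced by the point `ε + 2πi ω` of the right half-plane. -/
noncomputable def dampedEnergy (a ε : ℝ) (φ : Test) : ℝ :=
  ∫ ω, ‖laplacePoint ε ω‖ ^ (-a) * ‖fourierOfReal (testDeriv φ) ω‖ ^ 2

section

variable {a β ε : ℝ}

theorem measurable_laplacePoint (ε : ℝ) : Measurable (laplacePoint ε) := by
  unfold laplacePoint
  fun_prop

theorem measurable_fourierOfReal_testDeriv (φ : Test) :
    Measurable (fourierOfReal (testDeriv φ)) :=
  (continuous_fourierOfReal (test_integrable' _)).measurable

theorem aestronglyMeasurable_dampedEnergy (a ε : ℝ) (φ : Test) :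
    AEStronglyMeasurable
      (fun ω => ‖laplacePoint ε ω‖ ^ (-a) * ‖fourierOfReal (testDeriv φ) ω‖ ^ 2) :=
  (((measurable_laplacePoint ε).norm.pow_const _).mul
    ((measurable_fourierOfReal_testDeriv φ).norm.pow_const 2)).aestronglyMeasurable

theorem two_pi_rpow_mul_norm_sq (φ : Test) {ω : ℝ} (hω : ω ≠ 0) :
    (2 * Real.pi * |ω|) ^ (-a) * ‖fourierOfReal (testDeriv φ) ω‖ ^ 2
      = (2 * Real.pi) ^ (2 - a) * (|ω| ^ (2 * (1 - a / 2)) * ‖fourierOfReal φ ω‖ ^ 2) := by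
  have h : 0 < 2 * Real.pi * |ω| := by positivity
  rw [norm_fourierOfReal_testDeriv, mul_pow, ← mul_assoc, ← Real.rpow_two (2 * _ * _),
    ← Real.rpow_add h, Real.mul_rpow (by positivity) (abs_nonneg _)]
  ring_nf

theorem norm_laplacePoint_rpow_mul_le (ha : 0 ≤ a) (φ : Test) {ω : ℝ} (hω : ω ≠ 0) :
    ‖laplacePoint ε ω‖ ^ (-a) * ‖fourierOfReal (testDeriv φ) ω‖ ^ 2
      ≤ (2 * Real.pi) ^ (2 - a) * (|ω| ^ (2 * (1 - a / 2)) * ‖fourierOfReal φ ω‖ ^ 2) := by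
  rw [← two_pi_rpow_mul_norm_sq φ hω]
  exact mul_le_mul_of_nonneg_right (Real.rpow_le_rpow_of_nonpos (by positivity)
    (le_norm_laplacePoint ε ω) (neg_nonpos.2 ha)) (sq_nonneg _)

theorem integrable_energy_bound (ha2 : a ≤ 2) (φ : Test) :
    Integrable fun ω =>
      (2 * Real.pi) ^ (2 - a) * (|ω| ^ (2 * (1 - a / 2)) * ‖fourierOfReal φ ω‖ ^ 2) :=
  (integrable_energy (by linarith) φ).const_mul _

theorem integrable_dampedEnergy (ha0 : 0 ≤ a) (ha2 : a ≤ 2) (ε : ℝ) (φ : Test) :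
    Integrable fun ω => ‖laplacePoint ε ω‖ ^ (-a) * ‖fourierOfReal (testDeriv φ) ω‖ ^ 2 := by
  refine (integrable_energy_bound ha2 φ).mono' (aestronglyMeasurable_dampedEnergy a ε φ) ?_
  filter_upwards [Measure.ae_ne volume 0] with ω hω
  rw [Real.norm_of_nonneg (by positivity)]
  exact norm_laplacePoint_rpow_mul_le ha0 φ hω

theorem dampedEnergy_le (ha0 : 0 ≤ a) (ha2 : a ≤ 2) (ε : ℝ) (φ : Test) :
    dampedEnergy a ε φ ≤ (2 * Real.pi) ^ (2 - a) * energy (1 - a / 2) φ := by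
  rw [energy, ← integral_const_mul]
  refine integral_mono_ae (integrable_dampedEnergy ha0 ha2 ε φ) (integrable_energy_bound ha2 φ) ?_
  filter_upwards [Measure.ae_ne volume 0] with ω hω
  exact norm_laplacePoint_rpow_mul_le ha0 φ hω

theorem tendsto_dampedEnergy (ha0 : 0 ≤ a) (ha2 : a ≤ 2) (φ : Test) {e : ℕ → ℝ}
    (he : Tendsto e atTop (𝓝 0)) :
    Tendsto (fun n => dampedEnergy a (e n) φ) atTop
      (𝓝 ((2 * Real.pi) ^ (2 - a) * energy (1 - a / 2) φ)) := by
  rw [energy, ← integral_const_mul]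
  refine tendsto_integral_of_dominated_convergence _
    (fun n => aestronglyMeasurable_dampedEnergy a (e n) φ) (integrable_energy_bound ha2 φ)
    (fun n => ?_) ?_
  · filter_upwards [Measure.ae_ne volume 0] with ω hω
    rw [Real.norm_of_nonneg (by positivity)]
    exact norm_laplacePoint_rpow_mul_le ha0 φ hω
  · filter_upwards [Measure.ae_ne volume 0] with ω hω
    have hcont : Continuous fun ε => ‖laplacePoint ε ω‖ := by
      unfold laplacePoint
      fun_prop
    have hnorm : Tendsto (fun n => ‖laplacePoint (e n) ω‖) atTop (𝓝 (2 * Real.pi * |ω|)) := by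
      have h := (hcont.tendsto 0).comp he
      simpa [Function.comp_def, laplacePoint, abs_of_pos Real.pi_pos] using h
    rw [← two_pi_rpow_mul_norm_sq φ hω]
    exact (hnorm.rpow_const (Or.inl (by positivity))).mul_const _

theorem cos_mul_dampedEnergy_le (ha0 : 0 ≤ a) (ha2 : a ≤ 2) (hε : 0 < ε) (φ : Test) :
    Real.cos (a * (Real.pi / 2)) * dampedEnergy a ε φ
      ≤ ∫ ω, (laplacePoint ε ω ^ (-(a : ℂ))).re * ‖fourierOfReal (testDeriv φ) ω‖ ^ 2 := by
  have hmeas : Measurable fun ω =>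
      (laplacePoint ε ω ^ (-(a : ℂ))).re * ‖fourierOfReal (testDeriv φ) ω‖ ^ 2 :=
    (Complex.measurable_re.comp ((measurable_laplacePoint ε).pow_const _)).mul
      ((measurable_fourierOfReal_testDeriv φ).norm.pow_const 2)
  have hint := integrable_dampedEnergy ha0 ha2 ε φ
  rw [dampedEnergy, ← integral_const_mul]
  refine integral_mono (hint.const_mul _)
    (hint.mono' hmeas.aestronglyMeasurable (ae_of_all _ fun ω => ?_)) fun ω => ?_
  · rw [norm_mul, Real.norm_of_nonneg (sq_nonneg ‖_‖), ← Complex.norm_cpow_real, Complex.ofReal_neg]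
    exact mul_le_mul_of_nonneg_right (Complex.abs_re_le_norm _) (sq_nonneg _)
  · simp only [← mul_assoc]
    exact mul_le_mul_of_nonneg_right
      (cos_mul_norm_rpow_neg_le_re_cpow (by simpa using hε) ha0 ha2) (sq_nonneg _)

theorem integral_conv_testDeriv_sq (hβ : 0 < β) (hε : 0 < ε) (φ : Test) :
    ∫ x, (dampedKernel β ε ⋆ᵣ testDeriv φ) x * (dampedKernel β ε ⋆ᵣ testDeriv φ) x
      = dampedEnergy (2 * β) ε φ := by
  rw [integral_convolution_mul_convolution (integrable_dampedKernel hβ hε)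
    (integrable_dampedKernel hβ hε) (test_integrable' _) (testDeriv φ).continuous
    (testDeriv φ).hasCompactSupport (testDeriv φ).integrable_fourierOfReal, dampedEnergy]
  congr with ω
  rw [fourierOfReal_dampedKernel hβ hε, Complex.mul_conj, Complex.ofReal_re,
    Complex.normSq_eq_norm_sq, ← Complex.ofReal_neg, Complex.norm_cpow_real, ← Real.rpow_mul_natCast
    (norm_nonneg _)]
  ring_nf

theorem cos_mul_dampedEnergy_le_integral_conv_mul (hβ0 : 0 < β) (hβ2 : β ≤ 2) (hε : 0 < ε)
    (φ : Test) : Real.cos (β * (Real.pi / 2)) * dampedEnergy β ε φ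
      ≤ ∫ x, (dampedKernel β ε ⋆ᵣ testDeriv φ) x * testDeriv φ x := by
  rw [integral_convolution_mul (integrable_dampedKernel hβ0 hε) (test_integrable' _)
    (testDeriv φ).continuous (testDeriv φ).integrable_fourierOfReal]
  simp only [fourierOfReal_dampedKernel hβ0 hε]
  exact cos_mul_dampedEnergy_le hβ0.le hβ2 hε φ

/-- The multipliers of the two kernels are `z ^ (-β)` and its conjugate, so their sesquilinear
product is `z ^ (-2β)`, whose argument stays within `βπ`. -/
theorem cos_mul_dampedEnergy_le_integral_conv_mul_conv (hβ0 : 0 < β) (hβ1 : β ≤ 1) (hε : 0 < ε)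
    (φ : Test) : Real.cos (β * Real.pi) * dampedEnergy (2 * β) ε φ
      ≤ ∫ x, (dampedKernel β ε ⋆ᵣ testDeriv φ) x
        * ((fun t => dampedKernel β ε (-t)) ⋆ᵣ testDeriv φ) x := by
  have hK := integrable_dampedKernel hβ0 hε
  have hmult (ω : ℝ) : fourierOfReal (dampedKernel β ε) ω
      * conj (fourierOfReal (fun t => dampedKernel β ε (-t)) ω)
      = laplacePoint ε ω ^ (-((2 * β : ℝ) : ℂ)) := by
    have hz : laplacePoint ε ω ≠ 0 := fun h => hε.ne' (by simpa using congrArg Complex.re h)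
    rw [fourierOfReal_comp_neg, Complex.conj_conj, fourierOfReal_dampedKernel hβ0 hε,
      ← Complex.cpow_add _ _ hz]
    push_cast
    ring_nf
  rw [integral_convolution_mul_convolution hK hK.comp_neg (test_integrable' _)
    (testDeriv φ).continuous (testDeriv φ).hasCompactSupport
    (testDeriv φ).integrable_fourierOfReal]
  simp only [hmult]
  convert cos_mul_dampedEnergy_le (a := 2 * β) (by linarith) (by linarith) hε φ using 3
  ring

theorem conv_mul_conv_comp_neg_eq_zero {K : ℝ → ℝ} (hK : ∀ t ≤ 0, K t = 0) (φ : Test) {x : ℝ}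
    (hx : x ∉ Ioo (0 : ℝ) 1) : (K ⋆ᵣ φ) x * ((fun t => K (-t)) ⋆ᵣ φ) x = 0 := by
  simp only [convolution_def, ContinuousLinearMap.mul_apply']
  rcases le_or_gt x 0 with h0 | h0
  · refine mul_eq_zero_of_left (integral_eq_zero_of_ae (ae_of_all _ fun t => ?_)) _
    rcases le_or_gt t 0 with ht | ht
    · simp [hK t ht]
    · simp [φ.eq_zero_of_notMem (x := x - t) fun h => by linarith [h.1]]
  · have h1 : 1 ≤ x := not_lt.1 fun h => hx ⟨h0, h⟩
    refine mul_eq_zero_of_right _ (integral_eq_zero_of_ae (ae_of_all _ fun t => ?_))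
    rcases le_or_gt (-t) 0 with ht | ht
    · simp [hK (-t) ht]
    · simp [φ.eq_zero_of_notMem (x := x - t) fun h => by linarith [h.2]]

theorem setIntegral_Ioo_conv_sq_le {K : ℝ → ℝ} (hK : Integrable K) (φ : Test) :
    ∫ x in Ioo (0 : ℝ) 1, (K ⋆ᵣ φ) x * (K ⋆ᵣ φ) x ≤ ∫ x, (K ⋆ᵣ φ) x * (K ⋆ᵣ φ) x := by
  obtain ⟨C, -, hC⟩ := φ.exists_bound
  refine setIntegral_le_integral ?_ (ae_of_all _ fun x => mul_self_nonneg _)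
  exact (hK.integrable_convolution _ (test_integrable' _)).mul_bdd
    (continuous_conv hK _).aestronglyMeasurable (ae_of_all _ fun x => norm_conv_le hK hC x)

/-! ### The derivatives of the fractional integrals of a test function -/

/-- The derivative of the left fractional integral of order `β` of a test function. -/
noncomputable def leftDeriv (β : ℝ) (φ : Test) : ℝ → ℝ := unitKernel β ⋆ᵣ testDeriv φ

/-- The derivative of the right fractional integral of order `β` of a test function. -/
noncomputable def rightDeriv (β : ℝ) (φ : Test) : ℝ → ℝ :=
  (fun t => unitKernel β (-t)) ⋆ᵣ testDeriv φ

theorem dampedEnergy_two_mul_le (hβ0 : 0 < β) (hβ1 : β ≤ 1) (ε : ℝ) (φ : Test) :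
    dampedEnergy (2 * β) ε φ ≤ (2 * Real.pi) ^ (2 - 2 * β) * energy (1 - β) φ := by
  simpa using dampedEnergy_le (a := 2 * β) (by linarith) (by linarith) ε φ

theorem setIntegral_leftDeriv_sq_le (hβ0 : 0 < β) (hβ1 : β ≤ 1) (φ : Test) :
    ∫ x in Ioo (0 : ℝ) 1, leftDeriv β φ x * leftDeriv β φ x
      ≤ (2 * Real.pi) ^ (2 - 2 * β) * energy (1 - β) φ := by
  have happ := kernelApprox_dampedKernel hβ0
  refine le_of_tendsto' (happ.tendsto_integral_mul happ (testDeriv φ)) fun n => ?_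
  refine (setIntegral_Ioo_conv_sq_le (happ.integrable n) _).trans ?_
  rw [integral_conv_testDeriv_sq hβ0 (damping_pos n)]
  exact dampedEnergy_two_mul_le hβ0 hβ1 _ φ

theorem setIntegral_rightDeriv_sq_le (hβ0 : 0 < β) (hβ1 : β ≤ 1) (φ : Test) :
    ∫ x in Ioo (0 : ℝ) 1, rightDeriv β φ x * rightDeriv β φ x
      ≤ (2 * Real.pi) ^ (2 - 2 * β) * energy (1 - β) φ := by
  have happ := (kernelApprox_dampedKernel hβ0).comp_neg
  refine le_of_tendsto' (happ.tendsto_integral_mul happ (testDeriv φ)) fun n => ?_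
  refine (setIntegral_Ioo_conv_sq_le (happ.integrable n) _).trans ?_
  rw [integral_convolution_comp_neg_sq (integrable_dampedKernel hβ0 (damping_pos n))
    (test_integrable' _) (testDeriv φ).continuous (testDeriv φ).hasCompactSupport
    (testDeriv φ).integrable_fourierOfReal, integral_conv_testDeriv_sq hβ0 (damping_pos n)]
  exact dampedEnergy_two_mul_le hβ0 hβ1 _ φ

theorem le_setIntegral_leftDeriv_mul_rightDeriv (hβ0 : 0 < β) (hβ1 : β ≤ 1) (φ : Test) :
    Real.cos (β * Real.pi) * ((2 * Real.pi) ^ (2 - 2 * β) * energy (1 - β) φ)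
      ≤ ∫ x in Ioo (0 : ℝ) 1, leftDeriv β φ x * rightDeriv β φ x := by
  have happ := kernelApprox_dampedKernel hβ0
  have henergy := tendsto_dampedEnergy (a := 2 * β) (by linarith) (by linarith) φ tendsto_damping
  rw [mul_div_cancel_left₀ _ two_ne_zero] at henergy
  refine le_of_tendsto_of_tendsto' (henergy.const_mul _)
    (happ.tendsto_integral_mul happ.comp_neg (testDeriv φ)) fun n => ?_
  rw [setIntegral_eq_integral_of_forall_compl_eq_zero fun x hx =>
    conv_mul_conv_comp_neg_eq_zero (fun _ => dampedKernel_of_nonpos β _) _ hx]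
  exact cos_mul_dampedEnergy_le_integral_conv_mul_conv hβ0 hβ1 (damping_pos n) φ

theorem le_setIntegral_leftDeriv_mul_testDeriv (hβ0 : 0 < β) (hβ2 : β ≤ 2) (φ : Test) :
    Real.cos (β * (Real.pi / 2)) * ((2 * Real.pi) ^ (2 - β) * energy (1 - β / 2) φ)
      ≤ ∫ x in Ioo (0 : ℝ) 1, leftDeriv β φ x * testDeriv φ x :=
  le_of_tendsto_of_tendsto' ((tendsto_dampedEnergy hβ0.le hβ2 φ tendsto_damping).const_mul _)
    ((kernelApprox_dampedKernel hβ0).tendsto_integral_mul_test (testDeriv φ))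
    fun n => cos_mul_dampedEnergy_le_integral_conv_mul hβ0 hβ2 (damping_pos n) φ

theorem le_setIntegral_rightDeriv_mul_testDeriv (hβ0 : 0 < β) (hβ2 : β ≤ 2) (φ : Test) :
    Real.cos (β * (Real.pi / 2)) * ((2 * Real.pi) ^ (2 - β) * energy (1 - β / 2) φ)
      ≤ ∫ x in Ioo (0 : ℝ) 1, rightDeriv β φ x * testDeriv φ x := by
  refine le_of_tendsto_of_tendsto'
    ((tendsto_dampedEnergy hβ0.le hβ2 φ tendsto_damping).const_mul _)
    ((kernelApprox_dampedKernel hβ0).comp_neg.tendsto_integral_mul_test (testDeriv φ)) fun n => ?_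
  rw [integral_convolution_comp_neg_mul (integrable_dampedKernel hβ0 (damping_pos n))
    (test_integrable' _) (testDeriv φ).continuous (testDeriv φ).integrable_fourierOfReal]
  exact cos_mul_dampedEnergy_le_integral_conv_mul hβ0 hβ2 (damping_pos n) φ

end

/-! ### Test functions as elements of `L²(0, 1)` -/

theorem Test.integrable_mul (φ : Test) {μ : Measure ℝ} {f : ℝ → ℝ} (hf : Integrable f μ) :
    Integrable (fun x => f x * φ x) μ := by
  obtain ⟨C, -, hC⟩ := φ.exists_bound
  exact hf.mul_bdd (c := C) φ.continuous.aestronglyMeasurable (ae_of_all _ hC)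

/-- The class of a continuous function in `L²(0, 1)`. -/
noncomputable def contL2 {f : ℝ → ℝ} (hf : Continuous f) : L2 := (memLp_of_continuous hf).toLp f

theorem coeFn_contL2 {f : ℝ → ℝ} (hf : Continuous f) : contL2 hf =ᵐ[vol01] f := MemLp.coeFn_toLp _

theorem inner_eq_integral (f g : L2) : inner ℝ f g = ∫ x in Ioo (0 : ℝ) 1, f x * g x := by
  rw [L2.inner_def]
  congr with x
  exact mul_comm _ _

theorem inner_contL2 (h : L2) {f : ℝ → ℝ} (hf : Continuous f) :
    inner ℝ h (contL2 hf) = ∫ x in Ioo (0 : ℝ) 1, h x * f x := by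
  rw [inner_eq_integral]
  refine integral_congr_ae ?_
  filter_upwards [coeFn_contL2 hf] with x hx
  rw [hx]

theorem inner_contL2_contL2 {f g : ℝ → ℝ} (hf : Continuous f) (hg : Continuous g) :
    inner ℝ (contL2 hf) (contL2 hg) = ∫ x in Ioo (0 : ℝ) 1, f x * g x := by
  rw [inner_contL2]
  refine integral_congr_ae ?_
  filter_upwards [coeFn_contL2 hf] with x hx
  rw [hx]

/-- The inclusion of the test functions into `L²(0, 1)`. -/
noncomputable def testL2 : Test →ₗ[ℝ] L2 where
  toFun φ := contL2 φ.continuous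
  map_add' _ _ := rfl
  map_smul' _ _ := rfl

theorem testL2_apply (φ : Test) : testL2 φ = contL2 φ.continuous := rfl

theorem norm_testL2_sq (φ : Test) : ‖testL2 φ‖ ^ 2 = ∫ x, φ x ^ 2 := by
  simp only [sq]
  rw [← real_inner_self_eq_norm_mul_norm, testL2_apply, inner_contL2_contL2,
    φ.setIntegral_eq_integral fun x hx => by rw [hx, mul_zero]]

/-- Differentiation of test functions, with values in `L²(0, 1)`. -/
noncomputable def testDerivL2 : Test →ₗ[ℝ] L2 where
  toFun φ := testL2 (testDeriv φ)
  map_add' φ ψ := by rw [testDeriv_add, map_add]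
  map_smul' c φ := by rw [testDeriv_smul, map_smul, RingHom.id_apply]

theorem testDerivL2_apply (φ : Test) : testDerivL2 φ = testL2 (testDeriv φ) := rfl

theorem norm_testDerivL2_sq (φ : Test) :
    ‖testDerivL2 φ‖ ^ 2 = (2 * Real.pi) ^ 2 * energy 1 φ := by
  rw [← integral_testDeriv_sq, testDerivL2_apply, norm_testL2_sq]

theorem inner_testL2 (h : L2) (φ : Test) :
    inner ℝ h (testL2 φ) = ∫ x in Ioo (0 : ℝ) 1, h x * φ x :=
  inner_contL2 h φ.continuous

theorem inner_testDerivL2 (h : L2) (φ : Test) :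
    inner ℝ h (testDerivL2 φ) = ∫ x in Ioo (0 : ℝ) 1, h x * deriv φ x :=
  inner_contL2 h (testDeriv φ).continuous

theorem hasWeakDeriv_iff_inner {w g : L2} :
    HasWeakDeriv w g ↔ ∀ φ : Test, inner ℝ w (testDerivL2 φ) = -inner ℝ g (testL2 φ) := by
  simp only [HasWeakDeriv, inner_testL2, inner_testDerivL2]

theorem HasWeakDeriv.of_tendsto {w g : L2} {W G : ℕ → L2} (h : ∀ n, HasWeakDeriv (W n) (G n))
    (hW : Tendsto W atTop (𝓝 w)) (hG : Tendsto G atTop (𝓝 g)) : HasWeakDeriv w g := by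
  simp only [hasWeakDeriv_iff_inner] at h ⊢
  intro φ
  refine tendsto_nhds_unique (hW.inner tendsto_const_nhds) ?_
  simp only [h _ φ]
  exact (hG.inner tendsto_const_nhds).neg

theorem setIntegral_mul_deriv_test {F F' : ℝ → ℝ} (hF : ∀ x, HasDerivAt F (F' x) x)
    (hF' : Continuous F') (φ : Test) :
    ∫ x in Ioo (0 : ℝ) 1, F x * deriv φ x = -∫ x in Ioo (0 : ℝ) 1, F' x * φ x := by
  have hFc : Continuous F := continuous_iff_continuousAt.2 fun x => (hF x).continuousAt
  have hi {f : ℝ → ℝ} (hf : Continuous f) (ψ : Test) : Integrable (fun x => f x * ψ x) :=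
    (hf.mul ψ.continuous).integrable_of_hasCompactSupport ψ.hasCompactSupport.mul_left
  rw [(testDeriv φ).setIntegral_eq_integral fun x hx => by rw [← coe_testDeriv, hx, mul_zero],
    φ.setIntegral_eq_integral fun x hx => by rw [hx, mul_zero]]
  exact integral_mul_deriv_eq_deriv_mul_of_integrable (fun x _ => hF x)
    (fun x _ => (φ.differentiable x).hasDerivAt) (hi hFc (testDeriv φ)) (hi hF' φ) (hi hFc φ)

theorem hasWeakDeriv_contL2 {F F' : ℝ → ℝ} (hF : ∀ x, HasDerivAt F (F' x) x)
    (hFc : Continuous F) (hF' : Continuous F') : HasWeakDeriv (contL2 hFc) (contL2 hF') := by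
  rw [hasWeakDeriv_iff_inner]
  intro φ
  rw [testDerivL2_apply, testL2_apply, testL2_apply, inner_contL2_contL2, inner_contL2_contL2]
  exact setIntegral_mul_deriv_test hF hF' φ

theorem hasWeakDeriv_test (φ : Test) : HasWeakDeriv (testL2 φ) (testDerivL2 φ) :=
  hasWeakDeriv_contL2 (fun x => (φ.differentiable x).hasDerivAt) φ.continuous
    (testDeriv φ).continuous

/-! ### The lemma of du Bois-Reymond -/

theorem Test.exists_Icc (η : Test) :
    ∃ a b : ℝ, 0 < a ∧ b < 1 ∧ ∀ x, x ∉ Icc a b → η x = 0 := by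
  set K := insert (1 / 2) (tsupport η)
  have hK : IsCompact K := IsCompact.insert η.hasCompactSupport _
  have hK01 : K ⊆ Ioo 0 1 := insert_subset (by norm_num) η.tsupport_subset
  have hne : K.Nonempty := insert_nonempty _ _
  refine ⟨sInf K, sSup K, (hK01 (hK.sInf_mem hne)).1, (hK01 (hK.sSup_mem hne)).2, fun x hx => ?_⟩
  by_contra hne
  have hxK : x ∈ K := mem_insert_of_mem _ (subset_tsupport _ hne)
  exact hx ⟨csInf_le hK.bddBelow hxK, le_csSup hK.bddAbove hxK⟩

theorem intervalIntegral_eq_zero_of_notMem_Icc {f : ℝ → ℝ} {a b x : ℝ} (ha : 0 < a)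
    (hf : ∀ x, x ∉ Icc a b → f x = 0) (h0 : ∫ x, f x = 0) (hx : x ∉ Icc a b) :
    ∫ t in (0 : ℝ)..x, f t = 0 := by
  rcases lt_or_ge x a with hxa | hax
  · refine intervalIntegral.integral_zero_ae (ae_of_all _ fun t ht => hf t fun htab => ?_)
    exact ht.2.not_gt ((max_lt ha hxa).trans_le htab.1)
  · have hbx : b < x := by
      by_contra! hxb
      exact hx ⟨hax, hxb⟩
    rw [intervalIntegral.integral_of_le (ha.le.trans hax),
      setIntegral_eq_integral_of_forall_compl_eq_zero fun t ht => hf t fun htab =>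
        ht (mem_Ioc.2 ⟨ha.trans_le htab.1, htab.2.trans hbx.le⟩), h0]

theorem exists_testDeriv_eq {η : Test} (h0 : ∫ x, η x = 0) : ∃ Φ : Test, testDeriv Φ = η := by
  obtain ⟨a, b, ha, hb, hab⟩ := η.exists_Icc
  have hderiv (x : ℝ) : HasDerivAt (fun x => ∫ t in (0 : ℝ)..x, η t) (η x) x :=
    η.continuous.integral_hasStrictDerivAt 0 x |>.hasDerivAt
  have hzero : ∀ x, x ∉ Icc a b → ∫ t in (0 : ℝ)..x, η t = 0 := fun x hx =>
    intervalIntegral_eq_zero_of_notMem_Icc ha hab h0 hx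
  have hsmooth : ContDiff ℝ (⊤ : ℕ∞) fun x => ∫ t in (0 : ℝ)..x, η t := by
    rw [contDiff_infty_iff_deriv, funext fun x => (hderiv x).deriv]
    exact ⟨fun x => (hderiv x).differentiableAt, η.contDiff⟩
  have hsupp : (tsupport fun x => ∫ t in (0 : ℝ)..x, η t) ⊆ Ioo 0 1 :=
    (closure_minimal (Function.support_subset_iff'.2 hzero) isClosed_Icc).trans
      (Icc_subset_Ioo ha hb)
  refine ⟨⟨_, hsmooth, HasCompactSupport.intro isCompact_Icc hzero, hsupp⟩, ?_⟩
  ext x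
  exact (hderiv x).deriv

theorem exists_test_integral_eq_one : ∃ χ : Test, ∫ x, χ x = 1 := by
  let f : ContDiffBump (1 / 2 : ℝ) := ⟨1 / 8, 1 / 4, by norm_num, by norm_num⟩
  refine ⟨⟨f.normed volume, f.contDiff_normed, f.hasCompactSupport_normed, ?_⟩, f.integral_normed⟩
  rw [f.tsupport_normed_eq, Real.closedBall_eq_Icc]
  exact Icc_subset_Ioo (by norm_num [f]) (by norm_num [f])

theorem exists_forall_setIntegral_mul_test_eq {h : ℝ → ℝ} (hh : IntegrableOn h (Ioo (0 : ℝ) 1))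
    (h0 : ∀ φ : Test, ∫ x in Ioo (0 : ℝ) 1, h x * deriv φ x = 0) :
    ∃ c : ℝ, ∀ η : Test, ∫ x in Ioo (0 : ℝ) 1, h x * η x = c * ∫ x, η x := by
  obtain ⟨χ, hχ⟩ := exists_test_integral_eq_one
  refine ⟨∫ x in Ioo (0 : ℝ) 1, h x * χ x, fun η => ?_⟩
  have hmean : ∫ x, (η - (∫ x, η x) • χ) x = 0 := by
    simp only [FunLike.coe_sub, FunLike.coe_smul, Pi.sub_apply, Pi.smul_apply, smul_eq_mul]
    rw [integral_sub (test_integrable' η) ((test_integrable' χ).const_mul _),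
      integral_const_mul, hχ, mul_one, sub_self]
  obtain ⟨Φ, hΦ⟩ := exists_testDeriv_eq hmean
  have horth := h0 Φ
  rw [← coe_testDeriv, hΦ] at horth
  simp only [FunLike.coe_sub, FunLike.coe_smul, Pi.sub_apply, Pi.smul_apply, smul_eq_mul,
    mul_sub, mul_left_comm (h _)] at horth
  rw [integral_sub (η.integrable_mul hh) ((χ.integrable_mul hh).const_mul _),
    integral_const_mul] at horth
  linarith

theorem ae_eq_const_of_forall_setIntegral_mul_deriv {h : ℝ → ℝ}
    (hh : IntegrableOn h (Ioo (0 : ℝ) 1))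
    (h0 : ∀ φ : Test, ∫ x in Ioo (0 : ℝ) 1, h x * deriv φ x = 0) :
    ∃ c : ℝ, h =ᵐ[vol01] fun _ => c := by
  obtain ⟨c, hc⟩ := exists_forall_setIntegral_mul_test_eq hh h0
  refine ⟨c, ?_⟩
  have hloc : LocallyIntegrableOn (fun x => h x - c) (Ioo (0 : ℝ) 1) volume :=
    IntegrableOn.locallyIntegrableOn (hh.sub (by simp))
  have hae := isOpen_Ioo.ae_eq_zero_of_integral_contDiff_smul_eq_zero hloc fun φ h1 h2 h3 => by
    let ψ : Test := ⟨φ, h1, h2, h3⟩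
    change ∫ x, ψ x • (h x - c) = 0
    rw [← ψ.setIntegral_eq_integral fun x hx => by rw [hx, zero_smul]]
    simp only [smul_eq_mul, mul_comm (ψ _), sub_mul]
    rw [integral_sub (ψ.integrable_mul hh) ((test_integrable' ψ).integrableOn.const_mul c),
      hc, integral_const_mul, ψ.setIntegral_eq_integral fun x hx => hx, sub_self]
  filter_upwards [(ae_restrict_iff' measurableSet_Ioo).2 hae] with x hx
  exact sub_eq_zero.1 hx

/-- The constant function `1` in `L²(0, 1)`. -/
noncomputable def oneL2 : L2 := contL2 (f := fun _ => 1) continuous_const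

theorem norm_oneL2 : ‖oneL2‖ = 1 := by
  rw [← pow_eq_one_iff_of_nonneg (norm_nonneg _) two_ne_zero, ← real_inner_self_eq_norm_sq,
    oneL2, inner_contL2_contL2]
  simp

theorem coeFn_smul_oneL2 (c : ℝ) : (c • oneL2 : L2) =ᵐ[vol01] fun _ => c := by
  filter_upwards [Lp.coeFn_smul c oneL2, coeFn_contL2 (f := fun _ => 1) continuous_const]
    with x hsmul hone
  rw [hsmul, Pi.smul_apply, oneL2, hone, smul_eq_mul, mul_one]

theorem hasWeakDeriv_oneL2 : HasWeakDeriv oneL2 0 :=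
  hasWeakDeriv_contL2 (fun x => hasDerivAt_const x 1) continuous_const continuous_const

theorem inner_oneL2_testDerivL2 (φ : Test) : inner ℝ oneL2 (testDerivL2 φ) = 0 := by
  rw [hasWeakDeriv_iff_inner.1 hasWeakDeriv_oneL2, inner_zero_left, neg_zero]

theorem exists_eq_smul_oneL2 {h : L2} (h0 : ∀ φ : Test, inner ℝ h (testDerivL2 φ) = 0) :
    ∃ c : ℝ, h = c • oneL2 := by
  obtain ⟨c, hc⟩ := ae_eq_const_of_forall_setIntegral_mul_deriv (L2_integrable h) fun φ => by
    rw [← inner_testDerivL2, h0]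
  exact ⟨c, Lp.ext (hc.trans (coeFn_smul_oneL2 c).symm)⟩

theorem exists_seq_tendsto_of_mem_closure_range {E F : Type*} [AddCommGroup E] [Module ℝ E]
    [NormedAddCommGroup F] [NormedSpace ℝ F] {T : E →ₗ[ℝ] F} {y : F}
    (hy : y ∈ (LinearMap.range T).topologicalClosure) :
    ∃ x : ℕ → E, Tendsto (fun n => T (x n)) atTop (𝓝 y) := by
  obtain ⟨z, hz, hlim⟩ := mem_closure_iff_seq_limit.1 hy
  choose x hx using hz
  exact ⟨x, by simpa only [hx] using hlim⟩

theorem exists_seq_testDerivL2 {g : L2} (hg : inner ℝ oneL2 g = 0) :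
    ∃ φ : ℕ → Test, Tendsto (fun n => testDerivL2 (φ n)) atTop (𝓝 g) := by
  refine exists_seq_tendsto_of_mem_closure_range ?_
  rw [← Submodule.orthogonal_orthogonal_eq_closure, Submodule.mem_orthogonal]
  intro h hh
  obtain ⟨c, rfl⟩ := exists_eq_smul_oneL2 (h := h) fun φ => by
    rw [real_inner_comm]
    exact hh _ ⟨φ, rfl⟩
  rw [real_inner_smul_left, hg, mul_zero]

/-! ### Sequential description of the spaces `H^μ₀` -/

/-- Sequences of test functions that are Cauchy for the homogeneous Sobolev seminorm of order `s`,
whose square is `energy s`. -/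
def EnergyCauchy (s : ℝ) (φ : ℕ → Test) : Prop :=
  Tendsto (fun p : ℕ × ℕ => energy s (φ p.1 - φ p.2)) atTop (𝓝 0)

section EnergyCauchy

variable {s : ℝ} {φ : ℕ → Test}

theorem EnergyCauchy.cauchySeq {E : Type*} [NormedAddCommGroup E] [NormedSpace ℝ E]
    {T : Test →ₗ[ℝ] E} {C : ℝ} (h : EnergyCauchy s φ) (hT : ∀ φ, ‖T φ‖ ^ 2 ≤ C * energy s φ) :
    CauchySeq fun n => T (φ n) := by
  rw [cauchySeq_iff_tendsto_dist_atTop_0]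
  refine squeeze_zero (fun _ => dist_nonneg) (fun p => ?_)
    (g := fun p => √(C * energy s (φ p.1 - φ p.2))) (by simpa using (h.const_mul C).sqrt)
  rw [dist_eq_norm, ← map_sub]
  exact Real.le_sqrt_of_sq_le (hT _)

theorem EnergyCauchy.of_cauchySeq {E : Type*} [NormedAddCommGroup E] [NormedSpace ℝ E]
    {T : Test →ₗ[ℝ] E} {C : ℝ} (h : CauchySeq fun n => T (φ n))
    (hT : ∀ φ, energy s φ ≤ C * ‖T φ‖ ^ 2) : EnergyCauchy s φ := by
  rw [cauchySeq_iff_tendsto_dist_atTop_0] at h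
  refine squeeze_zero (fun _ => energy_nonneg _ _) (fun p => ?_)
    (g := fun p => C * dist (T (φ p.1)) (T (φ p.2)) ^ 2) (by simpa using (h.pow 2).const_mul C)
  rw [dist_eq_norm, ← map_sub]
  exact hT _

theorem norm_testL2_sq_le (hs : 0 ≤ s) (φ : Test) :
    ‖testL2 φ‖ ^ 2 ≤ 2 * 4 ^ (2 * s) * energy s φ := by
  rw [norm_testL2_sq]
  exact integral_sq_le_energy hs φ

theorem EnergyCauchy.exists_tendsto (h : EnergyCauchy s φ) (hs : 0 ≤ s) :
    ∃ u : L2, Tendsto (fun n => testL2 (φ n)) atTop (𝓝 u) :=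
  cauchySeq_tendsto_of_complete (h.cauchySeq (norm_testL2_sq_le hs))

theorem sobolevSeminorm_eq_ofReal_sqrt (hs : 0 ≤ s) (φ : Test) :
    sobolevSeminorm s φ = ENNReal.ofReal √(energy s φ) := by
  rw [← (ENNReal.pow_right_strictMono two_ne_zero).injective.eq_iff, sobolevSeminorm_sq hs,
    ← ENNReal.ofReal_pow (Real.sqrt_nonneg _), Real.sq_sqrt (energy_nonneg s φ)]

theorem energyCauchy_iff_tendsto_sobolevSeminorm (hs : 0 ≤ s) :
    EnergyCauchy s φ ↔
      Tendsto (fun p : ℕ × ℕ => sobolevSeminorm s (φ p.1 - φ p.2 : Test)) atTop (𝓝 0) := by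
  simp only [sobolevSeminorm_eq_ofReal_sqrt hs]
  refine ⟨fun h => by simpa using ENNReal.tendsto_ofReal h.sqrt, fun h => ?_⟩
  have hsq := ((ENNReal.tendsto_toReal ENNReal.zero_ne_top).comp h).pow 2
  simpa [EnergyCauchy, Function.comp_def, ENNReal.toReal_ofReal, Real.sq_sqrt, energy_nonneg]
    using hsq

theorem coe_sub_zeroExt (φ : Test) (u : L2) :
    ⇑φ - zeroExt u = (Ioo (0 : ℝ) 1).indicator (⇑φ - ⇑u) := by
  ext x
  by_cases hx : x ∈ Ioo (0 : ℝ) 1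
  · simp [zeroExt, indicator_of_mem hx]
  · simp [zeroExt, indicator_of_notMem hx, φ.eq_zero_of_notMem hx]

theorem eLpNorm_coe_sub_zeroExt (φ : Test) (u : L2) (p : ℝ≥0∞) :
    eLpNorm (⇑φ - zeroExt u) p volume = eLpNorm (testL2 φ - u : L2) p vol01 := by
  rw [coe_sub_zeroExt, eLpNorm_indicator_eq_eLpNorm_restrict measurableSet_Ioo]
  refine eLpNorm_congr_ae ?_
  filter_upwards [Lp.coeFn_sub (testL2 φ) u, coeFn_contL2 φ.continuous] with x hsub hφ
  rw [hsub, Pi.sub_apply, Pi.sub_apply, testL2_apply, hφ]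

theorem eLpNorm_two_coe_sub_zeroExt (φ : Test) (u : L2) :
    eLpNorm (⇑φ - zeroExt u) 2 volume = ENNReal.ofReal ‖testL2 φ - u‖ := by
  rw [eLpNorm_coe_sub_zeroExt, Lp.norm_def, ENNReal.ofReal_toReal (Lp.eLpNorm_ne_top _)]

theorem integral_norm_coe_sub_zeroExt_le (φ : Test) (u : L2) :
    ∫ x, ‖(⇑φ - zeroExt u) x‖ ≤ ‖testL2 φ - u‖ := by
  have hi : Integrable (⇑φ - zeroExt u) := (test_integrable' φ).sub (zeroExt_integrable u)
  rw [integral_norm_eq_lintegral_enorm hi.aestronglyMeasurable, ← eLpNorm_one_eq_lintegral_enorm,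
    eLpNorm_coe_sub_zeroExt, Lp.norm_def]
  exact ENNReal.toReal_mono (Lp.eLpNorm_ne_top _)
    (eLpNorm_le_eLpNorm_of_exponent_le one_le_two (Lp.aestronglyMeasurable _))

theorem tendsto_fourierOfReal_test {u : L2} (h : Tendsto (fun n => testL2 (φ n)) atTop (𝓝 u))
    (ω : ℝ) : Tendsto (fun n => fourierOfReal (φ n) ω) atTop (𝓝 (fourierOfReal (zeroExt u) ω)) := by
  rw [tendsto_iff_norm_sub_tendsto_zero] at h ⊢
  refine squeeze_zero (fun _ => norm_nonneg _) (fun n => ?_) h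
  rw [← fourierOfReal_sub (test_integrable' _) (zeroExt_integrable u)]
  exact (norm_fourierOfReal_le _ ω).trans (integral_norm_coe_sub_zeroExt_le (φ n) u)

theorem sobolevSeminorm_sub_zeroExt_le {u : L2}
    (h : Tendsto (fun n => testL2 (φ n)) atTop (𝓝 u)) (ψ : Test) {c : ℝ≥0∞}
    (hc : ∀ᶠ n in atTop, sobolevSeminorm s (ψ - φ n : Test) ≤ c) :
    sobolevSeminorm s (⇑ψ - zeroExt u) ≤ c := by
  refine (Lp.eLpNorm_lim_le_liminf_eLpNorm (f := fun n (ω : ℝ) =>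
    ((|ω| ^ s : ℝ) : ℂ) * fourierOfReal (⇑ψ - ⇑(φ n)) ω)
    (fun n => fourier_aesm ((test_integrable' ψ).sub (test_integrable' (φ n))) s) _
    (ae_of_all _ fun ω => ?_)).trans (liminf_le_of_frequently_le' hc.frequently)
  change Tendsto _ _ (𝓝 (_ * fourierOfReal (⇑ψ - zeroExt u) ω))
  simp only [fourierOfReal_sub (test_integrable' ψ) (zeroExt_integrable u),
    fourierOfReal_sub (test_integrable' ψ) (test_integrable' _)]
  exact (tendsto_const_nhds.sub (tendsto_fourierOfReal_test h ω)).const_mul _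

theorem EnergyCauchy.mem_Hzero (h : EnergyCauchy s φ) (hs : 0 ≤ s) {u : L2}
    (hu : Tendsto (fun n => testL2 (φ n)) atTop (𝓝 u)) : u ∈ Hzero s := by
  refine ⟨φ, tendsto_sobolevNorm_iff.2 ⟨?_, ?_⟩⟩
  · simp only [eLpNorm_two_coe_sub_zeroExt]
    simpa using ENNReal.tendsto_ofReal (tendsto_iff_norm_sub_tendsto_zero.1 hu)
  · rw [energyCauchy_iff_tendsto_sobolevSeminorm hs, ENNReal.tendsto_nhds_zero] at h
    rw [ENNReal.tendsto_nhds_zero]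
    intro ε hε
    filter_upwards [eventually_atTop_curry (h ε hε)] with n hn
    exact sobolevSeminorm_sub_zeroExt_le hu (φ n) hn

theorem exists_energyCauchy (hs : 0 ≤ s) {u : L2} (hu : u ∈ Hzero s) :
    ∃ φ : ℕ → Test, EnergyCauchy s φ ∧ Tendsto (fun n => testL2 (φ n)) atTop (𝓝 u) := by
  obtain ⟨φ, hφ⟩ := hu
  obtain ⟨hL2, hseminorm⟩ := tendsto_sobolevNorm_iff.1 hφ
  refine ⟨φ, (energyCauchy_iff_tendsto_sobolevSeminorm hs).2 ?_, ?_⟩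
  · rw [← prod_atTop_atTop_eq]
    have hlim := (hseminorm.comp tendsto_fst).add (hseminorm.comp tendsto_snd)
    rw [add_zero] at hlim
    refine tendsto_of_tendsto_of_tendsto_of_le_of_le tendsto_const_nhds hlim
      (fun _ => zero_le) fun p => ?_
    have hi (k : ℕ) := (test_integrable' (φ k)).sub (zeroExt_integrable u)
    have hsplit : ⇑(φ p.1 - φ p.2) =
        (⇑(φ p.1) - zeroExt u) + (-1 : ℝ) • (⇑(φ p.2) - zeroExt u) := by
      rw [FunLike.coe_sub]
      module
    have hadd := sobolevSeminorm_add_le s (hi p.1) ((hi p.2).smul (-1 : ℝ))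
    rwa [sobolevSeminorm_smul, ← hsplit, enorm_neg, enorm_one, one_mul] at hadd
  · rw [tendsto_iff_norm_sub_tendsto_zero]
    simp only [eLpNorm_two_coe_sub_zeroExt] at hL2
    simpa [Function.comp_def, ENNReal.toReal_ofReal] using
      (ENNReal.tendsto_toReal ENNReal.zero_ne_top).comp hL2

end EnergyCauchy

/-! ### The space `H¹₀(0, 1)` -/

theorem energy_one_le (φ : Test) : energy 1 φ ≤ 1 / (2 * Real.pi) ^ 2 * ‖testDerivL2 φ‖ ^ 2 := by
  rw [norm_testDerivL2_sq]
  field_simp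
  rfl

theorem norm_testL2_sq_le_norm_testDerivL2_sq (φ : Test) :
    ‖testL2 φ‖ ^ 2 ≤ ‖testDerivL2 φ‖ ^ 2 := by
  have hconst : 2 * (4 : ℝ) ^ (2 * (1 : ℝ)) * (1 / (2 * Real.pi) ^ 2) ≤ 1 := by
    rw [mul_one, Real.rpow_two, mul_one_div, div_le_one (by positivity)]
    nlinarith [Real.pi_gt_three]
  calc ‖testL2 φ‖ ^ 2 ≤ 2 * 4 ^ (2 * (1 : ℝ)) * energy 1 φ := norm_testL2_sq_le zero_le_one φ
    _ ≤ 2 * 4 ^ (2 * (1 : ℝ)) * (1 / (2 * Real.pi) ^ 2 * ‖testDerivL2 φ‖ ^ 2) := by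
      gcongr
      exact energy_one_le φ
    _ ≤ ‖testDerivL2 φ‖ ^ 2 := by
      rw [← mul_assoc]
      exact mul_le_of_le_one_left (sq_nonneg _) hconst

theorem exists_seq_of_mem_Hzero_one {u : L2} (hu : u ∈ Hzero 1) :
    ∃ (φ : ℕ → Test) (g : L2), Tendsto (fun n => testL2 (φ n)) atTop (𝓝 u) ∧
      Tendsto (fun n => testDerivL2 (φ n)) atTop (𝓝 g) ∧ HasWeakDeriv u g := by
  obtain ⟨φ, hφ, hu⟩ := exists_energyCauchy zero_le_one hu
  obtain ⟨g, hg⟩ := cauchySeq_tendsto_of_complete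
    (hφ.cauchySeq fun φ => (norm_testDerivL2_sq φ).le)
  exact ⟨φ, g, hu, hg, HasWeakDeriv.of_tendsto (fun n => hasWeakDeriv_test (φ n)) hu hg⟩

theorem D_eq {w : H1} {g : L2} (h : HasWeakDeriv w g) : D w = g := (D_spec w).unique h

theorem inner_oneL2_D (w : H10) : inner ℝ oneL2 (D (w : H1)) = 0 := by
  obtain ⟨φ, g, -, hg, hwg⟩ := exists_seq_of_mem_Hzero_one (u := ((w : H1) : L2)) w.2
  rw [D_eq hwg]
  refine tendsto_nhds_unique (tendsto_const_nhds.inner hg) ?_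
  simp only [inner_oneL2_testDerivL2]
  exact tendsto_const_nhds

theorem eq_zero_of_D_eq_zero {w : H10} (h : D (w : H1) = 0) : w = 0 := by
  obtain ⟨φ, g, hu, hg, hwg⟩ := exists_seq_of_mem_Hzero_one (u := ((w : H1) : L2)) w.2
  obtain rfl : g = 0 := (D_eq hwg).symm.trans h
  have hle : ‖((w : H1) : L2)‖ ≤ ‖(0 : L2)‖ := le_of_tendsto_of_tendsto' hu.norm hg.norm fun n =>
    (sq_le_sq₀ (norm_nonneg _) (norm_nonneg _)).1 (norm_testL2_sq_le_norm_testDerivL2_sq (φ n))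
  exact Subtype.ext (Subtype.ext (norm_le_zero_iff.1 (hle.trans norm_zero.le)))

theorem exists_H10_D_eq {g : L2} (hg : inner ℝ oneL2 g = 0) : ∃ w : H10, D (w : H1) = g := by
  obtain ⟨φ, hφ⟩ := exists_seq_testDerivL2 hg
  have hE : EnergyCauchy 1 φ := EnergyCauchy.of_cauchySeq hφ.cauchySeq energy_one_le
  obtain ⟨u, hu⟩ := hE.exists_tendsto zero_le_one
  have hw := HasWeakDeriv.of_tendsto (fun n => hasWeakDeriv_test (φ n)) hu hφ
  exact ⟨⟨⟨u, g, hw⟩, hE.mem_Hzero zero_le_one hu⟩, D_eq hw⟩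

/-! ### Fractional integrals as convolutions -/

theorem unitKernel_mul_eq {β t : ℝ} (ht : t ∈ Ioo (0 : ℝ) 1) (y : ℝ) :
    unitKernel β t * y = 1 / Real.Gamma β * (y / t ^ (1 - β)) := by
  rw [unitKernel, indicator_of_mem ht, ← neg_sub 1 β, Real.rpow_neg ht.1.le]
  field_simp

theorem leftInt_eq_conv (β : ℝ) (u : L2) {x : ℝ} (hx : x ∈ Ioo (0 : ℝ) 1) :
    leftInt β u x = (unitKernel β ⋆ᵣ zeroExt u) x := by
  rw [leftInt, convolution_eq_swap, ← integral_const_mul, ← integral_indicator measurableSet_Ioo]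
  congr 1 with s
  rw [ContinuousLinearMap.mul_apply']
  by_cases hs : s ∈ Ioo 0 x
  · have hs01 : s ∈ Ioo (0 : ℝ) 1 := ⟨hs.1, hs.2.trans hx.2⟩
    have hxs : x - s ∈ Ioo (0 : ℝ) 1 := ⟨sub_pos.2 hs.2, by linarith [hs.1, hx.2]⟩
    rw [indicator_of_mem hs, zeroExt, indicator_of_mem hs01, unitKernel_mul_eq hxs]
  · rw [indicator_of_notMem hs]
    by_cases hs01 : s ∈ Ioo (0 : ℝ) 1
    · rw [unitKernel, indicator_of_notMem fun h => hs ⟨hs01.1, sub_pos.1 h.1⟩, zero_mul]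
    · rw [zeroExt, indicator_of_notMem hs01, mul_zero]

theorem rightInt_eq_conv (β : ℝ) (u : L2) {x : ℝ} (hx : x ∈ Ioo (0 : ℝ) 1) :
    rightInt β u x = ((fun t => unitKernel β (-t)) ⋆ᵣ zeroExt u) x := by
  rw [rightInt, convolution_eq_swap, ← integral_const_mul, ← integral_indicator measurableSet_Ioo]
  congr 1 with s
  rw [ContinuousLinearMap.mul_apply', neg_sub]
  by_cases hs : s ∈ Ioo x 1
  · have hs01 : s ∈ Ioo (0 : ℝ) 1 := ⟨hx.1.trans hs.1, hs.2⟩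
    have hsx : s - x ∈ Ioo (0 : ℝ) 1 := ⟨sub_pos.2 hs.1, by linarith [hs.2, hx.1]⟩
    rw [indicator_of_mem hs, zeroExt, indicator_of_mem hs01, unitKernel_mul_eq hsx]
  · rw [indicator_of_notMem hs]
    by_cases hs01 : s ∈ Ioo (0 : ℝ) 1
    · rw [unitKernel, indicator_of_notMem fun h => hs ⟨sub_pos.1 h.1, hs01.2⟩, zero_mul]
    · rw [zeroExt, indicator_of_notMem hs01, mul_zero]

section Convolution

variable {K : ℝ → ℝ} {φ : ℕ → Test} {u : L2}

theorem integrable_conv {f : ℝ → ℝ} (hK : Integrable K) (hf : Integrable f) :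
    Integrable (K ⋆ᵣ f) :=
  hK.integrable_convolution (ContinuousLinearMap.mul ℝ ℝ) hf

theorem integral_norm_conv_le {f : ℝ → ℝ} (hK : Integrable K) (hf : Integrable f) :
    ∫ x, ‖(K ⋆ᵣ f) x‖ ≤ (∫ t, ‖K t‖) * ∫ x, ‖f x‖ := by
  have h := integral_convolution (ContinuousLinearMap.mul ℝ ℝ) (μ := volume) (ν := volume)
    hK.norm hf.norm
  rw [ContinuousLinearMap.mul_apply'] at h
  rw [← h]
  refine integral_mono (integrable_conv hK hf).norm (integrable_conv hK.norm hf.norm) fun x => ?_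
  simp only [convolution_def, ContinuousLinearMap.mul_apply', ← norm_mul]
  exact norm_integral_le_integral_norm _

theorem conv_sub_ae_eq {f g : ℝ → ℝ} (hK : Integrable K) (hf : Integrable f) (hg : Integrable g) :
    K ⋆ᵣ (f - g) =ᵐ[volume] (K ⋆ᵣ f) - (K ⋆ᵣ g) := by
  filter_upwards [hK.ae_convolution_exists (ContinuousLinearMap.mul ℝ ℝ) hf,
    hK.ae_convolution_exists (ContinuousLinearMap.mul ℝ ℝ) hg] with x hfx hgx
  simp only [convolution_def, Pi.sub_apply, map_sub]
  exact integral_sub hfx hgx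

theorem integral_norm_conv_sub_conv_le {f g : ℝ → ℝ} (hK : Integrable K) (hf : Integrable f)
    (hg : Integrable g) :
    ∫ x, ‖(K ⋆ᵣ f) x - (K ⋆ᵣ g) x‖ ≤ (∫ t, ‖K t‖) * ∫ x, ‖(f - g) x‖ := by
  refine le_trans (integral_congr_ae ?_).le (integral_norm_conv_le hK (hf.sub hg))
  filter_upwards [conv_sub_ae_eq hK hf hg] with x hx
  rw [hx, Pi.sub_apply]

theorem tendsto_setIntegral_conv_mul (hK : Integrable K)
    (hu : Tendsto (fun n => testL2 (φ n)) atTop (𝓝 u)) (ψ : Test) :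
    Tendsto (fun n => ∫ x in Ioo (0 : ℝ) 1, (K ⋆ᵣ (φ n)) x * ψ x) atTop
      (𝓝 (∫ x in Ioo (0 : ℝ) 1, (K ⋆ᵣ zeroExt u) x * ψ x)) := by
  obtain ⟨C, hC0, hC⟩ := ψ.exists_bound
  have hKu := integrable_conv hK (zeroExt_integrable u)
  have hKφ (n : ℕ) := integrable_conv hK (test_integrable' (φ n))
  rw [tendsto_iff_norm_sub_tendsto_zero] at hu ⊢
  refine squeeze_zero (g := fun n => (∫ t, ‖K t‖) * ‖testL2 (φ n) - u‖ * C)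
    (fun _ => norm_nonneg _) (fun n => ?_) (by simpa using (hu.const_mul _).mul_const C)
  have hdiff := ((hKφ n).sub hKu).norm.mul_const C
  rw [← integral_sub (ψ.integrable_mul (hKφ n)).integrableOn (ψ.integrable_mul hKu).integrableOn]
  calc ‖∫ x in Ioo (0 : ℝ) 1, ((K ⋆ᵣ (φ n)) x * ψ x - (K ⋆ᵣ zeroExt u) x * ψ x)‖
      ≤ ∫ x in Ioo (0 : ℝ) 1, ‖(K ⋆ᵣ (φ n)) x - (K ⋆ᵣ zeroExt u) x‖ * C := by
        refine norm_integral_le_of_norm_le hdiff.integrableOn (ae_of_all _ fun x => ?_)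
        rw [← sub_mul, norm_mul]
        gcongr
        exact hC x
    _ ≤ ∫ x, ‖(K ⋆ᵣ (φ n)) x - (K ⋆ᵣ zeroExt u) x‖ * C :=
        setIntegral_le_integral hdiff (ae_of_all _ fun x => mul_nonneg (norm_nonneg _) hC0)
    _ = (∫ x, ‖(K ⋆ᵣ (φ n)) x - (K ⋆ᵣ zeroExt u) x‖) * C := integral_mul_const _ _
    _ ≤ (∫ t, ‖K t‖) * (∫ x, ‖(⇑(φ n) - zeroExt u) x‖) * C := by
        gcongr
        exact integral_norm_conv_sub_conv_le hK (test_integrable' _) (zeroExt_integrable u)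
    _ ≤ (∫ t, ‖K t‖) * ‖testL2 (φ n) - u‖ * C := by
        gcongr
        exact integral_norm_coe_sub_zeroExt_le (φ n) u

/-- The map `φ ↦ (K ⋆ φ)' = K ⋆ φ'` from test functions to `L²(0, 1)`. -/
noncomputable def convDerivL2 (hK : Integrable K) : Test →ₗ[ℝ] L2 where
  toFun φ := contL2 (continuous_conv hK (testDeriv φ))
  map_add' φ ψ := by
    have hadd : K ⋆ᵣ (testDeriv (φ + ψ)) = K ⋆ᵣ (testDeriv φ) + K ⋆ᵣ (testDeriv ψ) := by
      have hc (η : Test) : ConvolutionExists K η (ContinuousLinearMap.mul ℝ ℝ) volume :=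
        η.hasCompactSupport.convolutionExists_right _ hK.locallyIntegrable η.continuous
      rw [testDeriv_add, FunLike.coe_add]
      exact (hc _).distrib_add (hc _)
    simp only [contL2, hadd]
    rfl
  map_smul' c φ := by
    have hsmul : K ⋆ᵣ (testDeriv (c • φ)) = c • (K ⋆ᵣ (testDeriv φ)) := by
      rw [testDeriv_smul, FunLike.coe_smul]
      exact convolution_smul
    simp only [contL2, hsmul]
    rfl

theorem setIntegral_conv_mul_deriv (hK : Integrable K) {g : L2}
    (hu : Tendsto (fun n => testL2 (φ n)) atTop (𝓝 u))
    (hg : Tendsto (fun n => convDerivL2 hK (φ n)) atTop (𝓝 g)) (ψ : Test) :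
    ∫ x in Ioo (0 : ℝ) 1, (K ⋆ᵣ zeroExt u) x * deriv ψ x = -∫ x in Ioo (0 : ℝ) 1, g x * ψ x := by
  refine tendsto_nhds_unique (tendsto_setIntegral_conv_mul hK hu (testDeriv ψ)) ?_
  have hlim : Tendsto (fun n => -inner ℝ (convDerivL2 hK (φ n)) (testL2 ψ)) atTop
      (𝓝 (-inner ℝ g (testL2 ψ))) := (hg.inner tendsto_const_nhds).neg
  rw [inner_testL2] at hlim
  refine hlim.congr fun n => ?_
  have hderiv (x : ℝ) : HasDerivAt (K ⋆ᵣ (φ n)) ((K ⋆ᵣ (testDeriv (φ n))) x) x :=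
    (φ n).hasCompactSupport.hasDerivAt_convolution_right _ hK.locallyIntegrable
      ((φ n).contDiff.of_le (by simp)) x
  rw [coe_testDeriv, setIntegral_mul_deriv_test hderiv (continuous_conv hK _), testL2_apply]
  exact congrArg Neg.neg (inner_contL2_contL2 (continuous_conv hK (testDeriv (φ n))) ψ.continuous)

end Convolution

/-! ### Primitives of square integrable functions -/

theorem hasWeakDeriv_wr : HasWeakDeriv wr oneL2 :=
  hasWeakDeriv_contL2 (F := fun x => x) (fun x => hasDerivAt_id x) continuous_id continuous_const

theorem hasWeakDeriv_wl : HasWeakDeriv wl (-oneL2) :=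
  hasWeakDeriv_contL2 (F := fun x => 1 - x) (F' := fun _ => -1)
    (fun x => by simpa using (hasDerivAt_id x).const_sub 1) (by fun_prop) continuous_const

theorem inner_oneL2_sub (g : L2) : inner ℝ oneL2 (g - (inner ℝ oneL2 g : ℝ) • oneL2) = 0 := by
  rw [inner_sub_right, real_inner_smul_right, real_inner_self_eq_norm_sq, norm_oneL2]
  ring

theorem exists_hasWeakDeriv (g : L2) : ∃ w : L2, HasWeakDeriv w g := by
  obtain ⟨w, hw⟩ := exists_H10_D_eq (inner_oneL2_sub g)
  refine ⟨w + (inner ℝ oneL2 g : ℝ) • wr, ?_⟩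
  have h := (D_spec (w : H1)).add (hasWeakDeriv_wr.smul (inner ℝ oneL2 g))
  rwa [hw, sub_add_cancel] at h

theorem exists_hasWeakDeriv_ae_eq {F : ℝ → ℝ} (hF : IntegrableOn F (Ioo (0 : ℝ) 1)) {g : L2}
    (h : ∀ ψ : Test, ∫ x in Ioo (0 : ℝ) 1, F x * deriv ψ x
      = -∫ x in Ioo (0 : ℝ) 1, g x * ψ x) :
    ∃ w : L2, w =ᵐ[vol01] F ∧ HasWeakDeriv w g := by
  obtain ⟨w, hw⟩ := exists_hasWeakDeriv g
  obtain ⟨c, hc⟩ := ae_eq_const_of_forall_setIntegral_mul_deriv (hF.sub (L2_integrable w))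
    fun ψ => by
      have hFψ : IntegrableOn (fun x => F x * deriv ψ x) (Ioo (0 : ℝ) 1) :=
        (testDeriv ψ).integrable_mul hF
      simp only [Pi.sub_apply, sub_mul]
      rw [integral_sub hFψ (test_deriv_integrable ψ w), h ψ, hw ψ, sub_self]
  refine ⟨w + c • oneL2, ?_, by simpa using hw.add (hasWeakDeriv_oneL2.smul c)⟩
  filter_upwards [hc, Lp.coeFn_add w (c • oneL2), coeFn_smul_oneL2 c] with x hFx hadd hconst
  rw [hadd, Pi.add_apply, hconst, ← hFx, Pi.sub_apply, add_sub_cancel]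

/-! ### The method of continuity -/

section MethodOfContinuity

variable {𝕜 V H : Type*} [NontriviallyNormedField 𝕜] [NormedAddCommGroup V] [NormedSpace 𝕜 V]
  [NormedAddCommGroup H] [NormedSpace 𝕜 H] {c : ℝ}

theorem exists_rightInverse_norm_le {T : V →L[𝕜] H} (hc : 0 < c) (hT : ∀ v, c * ‖v‖ ≤ ‖T v‖)
    (hs : Function.Surjective T) : ∃ R : H →L[𝕜] V, (∀ y, T (R y) = y) ∧ ‖R‖ ≤ c⁻¹ := by
  have hinj : Function.Injective T := (injective_iff_map_eq_zero T).2 fun v hv => by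
    have hv' := hT v
    rw [hv, norm_zero] at hv'
    exact norm_le_zero_iff.1 (nonpos_of_mul_nonpos_right hv' hc)
  let e : V ≃ₗ[𝕜] H := LinearEquiv.ofBijective (T : V →ₗ[𝕜] H) ⟨hinj, hs⟩
  have he (y : H) : T (e.symm y) = y := e.apply_symm_apply y
  have hbound (y : H) : ‖e.symm y‖ ≤ c⁻¹ * ‖y‖ := by
    rw [← div_eq_inv_mul, le_div_iff₀' hc]
    exact (hT _).trans_eq (congrArg norm (he y))
  exact ⟨(e.symm : H →ₗ[𝕜] V).mkContinuous c⁻¹ hbound, he,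
    LinearMap.mkContinuous_norm_le _ (inv_nonneg.2 hc.le) _⟩

theorem surjective_of_norm_sub_lt [CompleteSpace H] {T T' : V →L[𝕜] H}
    (hT : ∀ v, c * ‖v‖ ≤ ‖T v‖) (hs : Function.Surjective T) (h : ‖T - T'‖ < c) :
    Function.Surjective T' := by
  have hc : 0 < c := (norm_nonneg _).trans_lt h
  obtain ⟨R, hTR, hR⟩ := exists_rightInverse_norm_le hc hT hs
  have hnorm : ‖(T - T').comp R‖ < 1 :=
    calc ‖(T - T').comp R‖ ≤ ‖T - T'‖ * ‖R‖ := ContinuousLinearMap.opNorm_comp_le _ _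
      _ ≤ ‖T - T'‖ * c⁻¹ := by gcongr
      _ < c * c⁻¹ := by gcongr
      _ = 1 := mul_inv_cancel₀ hc.ne'
  have hT'R : 1 - (T - T').comp R = T'.comp R := by
    ext y
    simp [hTR]
  obtain ⟨U, hU⟩ := hT'R ▸ isUnit_one_sub_of_norm_lt_one hnorm
  exact fun y => ⟨R ((↑U⁻¹ : H →L[𝕜] H) y), DFunLike.congr_fun (hU ▸ U.mul_inv) y⟩

theorem surjective_of_surjective_of_continuous [CompleteSpace H] {X : Type*} [TopologicalSpace X]
    [PreconnectedSpace X] {T : X → V →L[𝕜] H} (hT : Continuous T) (hc : 0 < c)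
    (hbound : ∀ x v, c * ‖v‖ ≤ ‖T x v‖) {x : X} (hx : Function.Surjective (T x)) (y : X) :
    Function.Surjective (T y) := by
  have hlc : IsLocallyConstant fun x => Function.Surjective (T x) := by
    refine (IsLocallyConstant.iff_eventually_eq _).2 fun x => ?_
    filter_upwards [(hT.tendsto x).eventually (Metric.ball_mem_nhds _ hc)] with y hy
    rw [dist_eq_norm] at hy
    exact propext ⟨fun h => surjective_of_norm_sub_lt (hbound y) h hy,
      fun h => surjective_of_norm_sub_lt (hbound x) h (by rwa [norm_sub_rev])⟩
  exact (hlc.apply_eq_of_preconnectedSpace x y).mp hx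

end MethodOfContinuity

/-! ### The derivatives of the one-sided fractional integrals -/

section TwoSidedDerivative

variable {β θ : ℝ}

theorem integrable_unitKernel_neg (hβ : 0 < β) : Integrable fun t => unitKernel β (-t) :=
  (integrable_unitKernel hβ).comp_neg

theorem continuous_leftDeriv (hβ : 0 < β) (φ : Test) : Continuous (leftDeriv β φ) :=
  continuous_conv (integrable_unitKernel hβ) (testDeriv φ)

theorem continuous_rightDeriv (hβ : 0 < β) (φ : Test) : Continuous (rightDeriv β φ) :=
  continuous_conv (integrable_unitKernel_neg hβ) (testDeriv φ)

/-- The map taking `φ` to the derivatives of its left and right fractional integrals. -/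
noncomputable def oneSidedDerivs (hβ : 0 < β) : Test →ₗ[ℝ] L2 × L2 :=
  (convDerivL2 (integrable_unitKernel hβ)).prod (convDerivL2 (integrable_unitKernel_neg hβ))

theorem norm_oneSidedDerivs_fst_sq_le (hβ : 0 < β) (hβ1 : β ≤ 1) (φ : Test) :
    ‖(oneSidedDerivs hβ φ).1‖ ^ 2 ≤ (2 * Real.pi) ^ (2 - 2 * β) * energy (1 - β) φ := by
  rw [← real_inner_self_eq_norm_sq]
  exact (inner_contL2_contL2 (continuous_leftDeriv hβ φ)
    (continuous_leftDeriv hβ φ)).trans_le (setIntegral_leftDeriv_sq_le hβ hβ1 φ)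

theorem norm_oneSidedDerivs_snd_sq_le (hβ : 0 < β) (hβ1 : β ≤ 1) (φ : Test) :
    ‖(oneSidedDerivs hβ φ).2‖ ^ 2 ≤ (2 * Real.pi) ^ (2 - 2 * β) * energy (1 - β) φ := by
  rw [← real_inner_self_eq_norm_sq]
  exact (inner_contL2_contL2 (continuous_rightDeriv hβ φ)
    (continuous_rightDeriv hβ φ)).trans_le (setIntegral_rightDeriv_sq_le hβ hβ1 φ)

theorem norm_oneSidedDerivs_sq_le (hβ : 0 < β) (hβ1 : β ≤ 1) (φ : Test) :
    ‖oneSidedDerivs hβ φ‖ ^ 2 ≤ (2 * Real.pi) ^ (2 - 2 * β) * energy (1 - β) φ := by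
  rcases max_choice ‖(oneSidedDerivs hβ φ).1‖ ‖(oneSidedDerivs hβ φ).2‖ with h | h
  · rw [Prod.norm_def, h]
    exact norm_oneSidedDerivs_fst_sq_le hβ hβ1 φ
  · rw [Prod.norm_def, h]
    exact norm_oneSidedDerivs_snd_sq_le hβ hβ1 φ

theorem le_inner_oneSidedDerivs (hβ : 0 < β) (hβ1 : β ≤ 1) (φ : Test) :
    Real.cos (β * Real.pi) * ((2 * Real.pi) ^ (2 - 2 * β) * energy (1 - β) φ)
      ≤ inner ℝ (oneSidedDerivs hβ φ).1 (oneSidedDerivs hβ φ).2 :=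
  (le_setIntegral_leftDeriv_mul_rightDeriv hβ hβ1 φ).trans_eq (inner_contL2_contL2
    (continuous_leftDeriv hβ φ) (continuous_rightDeriv hβ φ)).symm

theorem cos_mul_pi_pos (hβ : 0 < β) (hβ1 : β < 1 / 2) : 0 < Real.cos (β * Real.pi) :=
  Real.cos_pos_of_mem_Ioo ⟨by nlinarith [Real.pi_pos], by nlinarith [Real.pi_pos]⟩

theorem energy_le_norm_oneSidedDerivs_sq (hβ : 0 < β) (hβ1 : β < 1 / 2) (φ : Test) :
    energy (1 - β) φ ≤
      (Real.cos (β * Real.pi) * (2 * Real.pi) ^ (2 - 2 * β))⁻¹ * ‖oneSidedDerivs hβ φ‖ ^ 2 := by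
  have hc : 0 < Real.cos (β * Real.pi) * (2 * Real.pi) ^ (2 - 2 * β) :=
    mul_pos (cos_mul_pi_pos hβ hβ1) (by positivity)
  rw [← div_eq_inv_mul, le_div_iff₀' hc]
  calc Real.cos (β * Real.pi) * (2 * Real.pi) ^ (2 - 2 * β) * energy (1 - β) φ
      ≤ inner ℝ (oneSidedDerivs hβ φ).1 (oneSidedDerivs hβ φ).2 := by
        rw [mul_assoc]
        exact le_inner_oneSidedDerivs hβ (by linarith) φ
    _ ≤ ‖(oneSidedDerivs hβ φ).1‖ * ‖(oneSidedDerivs hβ φ).2‖ := real_inner_le_norm _ _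
    _ ≤ ‖oneSidedDerivs hβ φ‖ ^ 2 := by
        rw [sq]
        exact mul_le_mul (norm_fst_le _) (norm_snd_le _) (norm_nonneg _) (norm_nonneg _)

theorem le_inner_oneSidedDerivs_testDerivL2 (hβ : 0 < β) (hβ2 : β ≤ 2) (hθ0 : 0 ≤ θ) (hθ1 : θ ≤ 1)
    (φ : Test) :
    Real.cos (β * (Real.pi / 2)) * ((2 * Real.pi) ^ (2 - β) * energy (1 - β / 2) φ) ≤
      inner ℝ (θ • (oneSidedDerivs hβ φ).1 + (1 - θ) • (oneSidedDerivs hβ φ).2)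
        (testDerivL2 φ) := by
  have hleft := (le_setIntegral_leftDeriv_mul_testDeriv hβ hβ2 φ).trans_eq
    (inner_contL2_contL2 (continuous_leftDeriv hβ φ) (testDeriv φ).continuous).symm
  have hright := (le_setIntegral_rightDeriv_mul_testDeriv hβ hβ2 φ).trans_eq
    (inner_contL2_contL2 (continuous_rightDeriv hβ φ) (testDeriv φ).continuous).symm
  rw [inner_add_left, real_inner_smul_left, real_inner_smul_left]
  refine le_of_eq_of_le ?_ (add_le_add (mul_le_mul_of_nonneg_left hleft hθ0)
    (mul_le_mul_of_nonneg_left hright (sub_nonneg.2 hθ1)))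
  ring

/-- The closure of the pairs of derivatives of the left and right fractional integrals of test
functions. As the norm of such a pair is equivalent to the norm of the test function in
`H^{1-β}(ℝ)`, this is a copy of `H^{1-β}₀(0, 1)` on which the operator
`φ ↦ (I^β_θ φ)'` reads `(v₁, v₂) ↦ θ v₁ + (1 - θ) v₂`. -/
noncomputable def oneSidedDerivSpace (hβ : 0 < β) : Submodule ℝ (L2 × L2) :=
  (LinearMap.range (oneSidedDerivs hβ)).topologicalClosure

instance (hβ : 0 < β) : CompleteSpace (oneSidedDerivSpace hβ) :=
  (Submodule.isClosed_topologicalClosure _).completeSpace_coe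

theorem oneSidedDerivs_mem (hβ : 0 < β) (φ : Test) :
    oneSidedDerivs hβ φ ∈ oneSidedDerivSpace hβ :=
  Submodule.le_topologicalClosure _ ⟨φ, rfl⟩

theorem mem_oneSidedDerivSpace_of_tendsto (hβ : 0 < β) {φ : ℕ → Test} {v : L2 × L2}
    (hv : Tendsto (fun n => oneSidedDerivs hβ (φ n)) atTop (𝓝 v)) :
    v ∈ oneSidedDerivSpace hβ :=
  (Submodule.isClosed_topologicalClosure _).mem_of_tendsto hv
    (Eventually.of_forall fun n => oneSidedDerivs_mem hβ (φ n))

theorem EnergyCauchy.exists_tendsto_oneSidedDerivs (hβ : 0 < β) (hβ1 : β ≤ 1) {φ : ℕ → Test}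
    (h : EnergyCauchy (1 - β) φ) : ∃ v : oneSidedDerivSpace hβ,
      Tendsto (fun n => oneSidedDerivs hβ (φ n)) atTop (𝓝 (v : L2 × L2)) := by
  obtain ⟨v, hv⟩ :=
    cauchySeq_tendsto_of_complete (h.cauchySeq (norm_oneSidedDerivs_sq_le hβ hβ1))
  exact ⟨⟨v, mem_oneSidedDerivSpace_of_tendsto hβ hv⟩, hv⟩

theorem cos_mul_norm_sq_le_inner (hβ : 0 < β) (hβ1 : β ≤ 1 / 2) {v : L2 × L2}
    (hv : v ∈ oneSidedDerivSpace hβ) : Real.cos (β * Real.pi) * ‖v‖ ^ 2 ≤ inner ℝ v.1 v.2 := by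
  have hcos : 0 ≤ Real.cos (β * Real.pi) :=
    Real.cos_nonneg_of_mem_Icc ⟨by nlinarith [Real.pi_pos], by nlinarith [Real.pi_pos]⟩
  obtain ⟨φ, hφ⟩ := exists_seq_tendsto_of_mem_closure_range hv
  refine le_of_tendsto_of_tendsto' ((hφ.norm.pow 2).const_mul _)
    (hφ.fst_nhds.inner hφ.snd_nhds) fun n => ?_
  calc Real.cos (β * Real.pi) * ‖oneSidedDerivs hβ (φ n)‖ ^ 2
      ≤ Real.cos (β * Real.pi) * ((2 * Real.pi) ^ (2 - 2 * β) * energy (1 - β) (φ n)) := by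
        gcongr
        exact norm_oneSidedDerivs_sq_le hβ (by linarith) (φ n)
    _ ≤ inner ℝ (oneSidedDerivs hβ (φ n)).1 (oneSidedDerivs hβ (φ n)).2 :=
        le_inner_oneSidedDerivs hβ (by linarith) (φ n)

/-- The operator `φ ↦ (I^β_θ φ)'`, read on `oneSidedDerivSpace`. -/
noncomputable def twoSidedDeriv (hβ : 0 < β) (θ : ℝ) : oneSidedDerivSpace hβ →L[ℝ] L2 :=
  θ • (ContinuousLinearMap.fst ℝ L2 L2 ∘L (oneSidedDerivSpace hβ).subtypeL) +
    (1 - θ) • (ContinuousLinearMap.snd ℝ L2 L2 ∘L (oneSidedDerivSpace hβ).subtypeL)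

theorem twoSidedDeriv_apply (hβ : 0 < β) (θ : ℝ) (v : oneSidedDerivSpace hβ) :
    twoSidedDeriv hβ θ v = θ • (v : L2 × L2).1 + (1 - θ) • (v : L2 × L2).2 := rfl

theorem inner_le_inner_convexCombination_add {E : Type*} [NormedAddCommGroup E]
    [InnerProductSpace ℝ E] (hθ0 : 0 ≤ θ) (hθ1 : θ ≤ 1) (a b : E) :
    inner ℝ a b ≤ inner ℝ (θ • a + (1 - θ) • b) (a + b) := by
  simp only [inner_add_left, inner_add_right, real_inner_smul_left, real_inner_self_eq_norm_sq,
    real_inner_comm a b]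
  linarith [mul_nonneg hθ0 (sq_nonneg ‖a‖), mul_nonneg (sub_nonneg.2 hθ1) (sq_nonneg ‖b‖)]

theorem norm_le_norm_twoSidedDeriv (hβ : 0 < β) (hβ1 : β ≤ 1 / 2) (hθ0 : 0 ≤ θ) (hθ1 : θ ≤ 1)
    (v : oneSidedDerivSpace hβ) :
    Real.cos (β * Real.pi) / 2 * ‖v‖ ≤ ‖twoSidedDeriv hβ θ v‖ := by
  rcases (norm_nonneg v).eq_or_lt with hv | hv
  · rw [← hv, mul_zero]
    exact norm_nonneg _
  obtain ⟨⟨a, b⟩, hab⟩ := v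
  have hquad : Real.cos (β * Real.pi) * ‖(a, b)‖ ^ 2 ≤
      ‖θ • a + (1 - θ) • b‖ * (2 * ‖(a, b)‖) :=
    calc Real.cos (β * Real.pi) * ‖(a, b)‖ ^ 2
        ≤ inner ℝ a b := cos_mul_norm_sq_le_inner hβ hβ1 hab
      _ ≤ inner ℝ (θ • a + (1 - θ) • b) (a + b) :=
          inner_le_inner_convexCombination_add hθ0 hθ1 a b
      _ ≤ ‖θ • a + (1 - θ) • b‖ * ‖a + b‖ := real_inner_le_norm _ _
      _ ≤ ‖θ • a + (1 - θ) • b‖ * (2 * ‖(a, b)‖) := by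
          gcongr
          exact (norm_add_le a b).trans
            (by linarith [norm_fst_le (a, b), norm_snd_le (a, b)])
  rw [twoSidedDeriv_apply]
  refine le_of_mul_le_mul_right ?_ hv
  simp only [Submodule.coe_norm]
  linarith

/-! ### The left operator is not onto -/

theorem integral_mul_conv_test {K g : ℝ → ℝ} (hK : Integrable K) (hg : Integrable g) (φ : Test) :
    ∫ x, g x * (K ⋆ᵣ φ) x = ∫ s, ((fun t => K (-t)) ⋆ᵣ g) s * φ s := by
  have hint : Integrable (fun p : ℝ × ℝ => K (p.1 - p.2) * g p.1 * φ p.2)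
      (volume.prod volume) := by
    obtain ⟨C, -, hC⟩ := φ.exists_bound
    have hKg := (hg.convolution_integrand (ContinuousLinearMap.mul ℝ ℝ) hK.comp_neg).swap
    refine (hKg.mul_bdd (c := C) (g := fun p : ℝ × ℝ => φ p.2)
      (φ.continuous.comp continuous_snd).aestronglyMeasurable
      (ae_of_all _ fun p => hC _)).congr (ae_of_all _ fun p => ?_)
    simp [mul_comm (g _)]
  calc ∫ x, g x * (K ⋆ᵣ φ) x = ∫ x, ∫ s, K (x - s) * g x * φ s := by
        congr 1 with x
        rw [convolution_eq_swap, ← integral_const_mul]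
        congr 1 with s
        rw [ContinuousLinearMap.mul_apply', ← mul_assoc, mul_comm (g x)]
    _ = ∫ s, ∫ x, K (x - s) * g x * φ s := integral_integral_swap hint
    _ = ∫ s, ((fun t => K (-t)) ⋆ᵣ g) s * φ s := by
        congr 1 with s
        rw [convolution_eq_swap, integral_mul_const]
        simp only [ContinuousLinearMap.mul_apply', neg_sub]

theorem inner_convDerivL2 {K : ℝ → ℝ} (hK : Integrable K) (u : L2) (φ : Test) :
    inner ℝ u (convDerivL2 hK φ) = ∫ s, ((fun t => K (-t)) ⋆ᵣ zeroExt u) s * testDeriv φ s := by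
  rw [← integral_mul_conv_test hK (zeroExt_integrable u)]
  simp only [zeroExt, ← indicator_mul_left]
  rw [integral_indicator measurableSet_Ioo]
  exact inner_contL2 u (continuous_conv hK (testDeriv φ))

theorem rightInt_one_sub_rpow (β : ℝ) {s : ℝ} (hs : s < 1) :
    rightInt β (fun x => (1 - x) ^ (-β)) s = rightInt β (fun x => (1 - x) ^ (-β)) 0 := by
  have hs0 : 0 < 1 - s := sub_pos.2 hs
  have hscale {t : ℝ} (ht : t ∈ Icc (0 : ℝ) 1) :
      (1 - s) * ((1 - ((1 - s) * t + s)) ^ (-β) / ((1 - s) * t + s - s) ^ (1 - β)) =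
        (1 - t) ^ (-β) / (t - 0) ^ (1 - β) := by
    rw [show 1 - ((1 - s) * t + s) = (1 - s) * (1 - t) by ring, add_sub_cancel_right, sub_zero,
      Real.mul_rpow hs0.le (sub_nonneg.2 ht.2), Real.mul_rpow hs0.le ht.1, sub_eq_add_neg 1 β,
      Real.rpow_add hs0, Real.rpow_one]
    have := (Real.rpow_pos_of_pos hs0 (-β)).ne'
    field_simp
  simp only [rightInt, ← integral_Ioc_eq_integral_Ioo,
    ← intervalIntegral.integral_of_le hs.le, ← intervalIntegral.integral_of_le zero_le_one]
  congr 1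
  have hsubst := intervalIntegral.mul_integral_comp_mul_add (a := 0) (b := 1)
    (f := fun x => (1 - x) ^ (-β) / (x - s) ^ (1 - β)) (1 - s) s
  rw [mul_zero, zero_add, mul_one, sub_add_cancel, ← intervalIntegral.integral_const_mul] at hsubst
  rw [← hsubst]
  refine intervalIntegral.integral_congr fun t ht => hscale ?_
  rwa [uIcc_of_le zero_le_one] at ht

theorem memLp_one_sub_rpow (hβ1 : β < 1 / 2) :
    MemLp (fun x : ℝ => (1 - x) ^ (-β)) 2 vol01 := by
  have hm : AEStronglyMeasurable (fun x : ℝ => (1 - x) ^ (-β)) vol01 :=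
    Measurable.aestronglyMeasurable (by fun_prop)
  rw [memLp_two_iff_integrable_sq hm]
  have hint := (intervalIntegral.intervalIntegrable_rpow' (a := 0) (b := 1)
    (r := -β * 2) (by linarith)).comp_sub_left 1 |>.symm
  rw [sub_zero, sub_self, intervalIntegrable_iff_integrableOn_Ioo_of_le zero_le_one] at hint
  refine hint.congr_fun (fun x hx => ?_) measurableSet_Ioo
  exact_mod_cast Real.rpow_mul (sub_pos.2 hx.2).le (-β) 2

/-- The function `(1 - x)^(-β)` in `L²(0, 1)`, which turns out to be orthogonal to the derivatives
of all left fractional integrals. -/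
noncomputable def edgeL2 (hβ1 : β < 1 / 2) : L2 := (memLp_one_sub_rpow hβ1).toLp _

theorem coeFn_edgeL2 (hβ1 : β < 1 / 2) :
    edgeL2 hβ1 =ᵐ[vol01] fun x => (1 - x) ^ (-β) := MemLp.coeFn_toLp _

theorem edgeL2_ne_zero (hβ1 : β < 1 / 2) : edgeL2 hβ1 ≠ 0 := by
  intro h
  have hfalse : ∀ᵐ _ ∂vol01, False := by
    filter_upwards [coeFn_edgeL2 hβ1, Lp.coeFn_zero ℝ 2 vol01, ae_restrict_mem measurableSet_Ioo]
      with x hedge hzero hx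
    rw [h, hzero] at hedge
    exact (Real.rpow_pos_of_pos (sub_pos.2 hx.2) (-β)).ne hedge
  exact hfalse.exists.choose_spec

theorem rightInt_edgeL2 (hβ1 : β < 1 / 2) {s : ℝ} (hs : s ∈ Ioo (0 : ℝ) 1) :
    rightInt β (edgeL2 hβ1) s = rightInt β (fun x => (1 - x) ^ (-β)) 0 := by
  rw [← rightInt_one_sub_rpow β hs.2, rightInt, rightInt]
  congr 1
  refine integral_congr_ae ?_
  filter_upwards [ae_restrict_of_ae_restrict_of_subset (Ioo_subset_Ioo_left hs.1.le)
    (coeFn_edgeL2 hβ1)] with x hx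
  rw [hx]

theorem inner_edgeL2_oneSidedDerivs_fst (hβ : 0 < β) (hβ1 : β < 1 / 2) (φ : Test) :
    inner ℝ (edgeL2 hβ1) (oneSidedDerivs hβ φ).1 = 0 := by
  set c := rightInt β (fun x => (1 - x) ^ (-β)) 0
  calc inner ℝ (edgeL2 hβ1) (oneSidedDerivs hβ φ).1
      = ∫ s, ((fun t => unitKernel β (-t)) ⋆ᵣ zeroExt (edgeL2 hβ1)) s * testDeriv φ s :=
        inner_convDerivL2 (integrable_unitKernel hβ) _ φ
    _ = ∫ s in Ioo (0 : ℝ) 1,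
          ((fun t => unitKernel β (-t)) ⋆ᵣ zeroExt (edgeL2 hβ1)) s * testDeriv φ s :=
        ((testDeriv φ).setIntegral_eq_integral fun s hs => by rw [hs, mul_zero]).symm
    _ = ∫ s in Ioo (0 : ℝ) 1, c * deriv φ s :=
        setIntegral_congr_fun measurableSet_Ioo fun s hs => by
          rw [← rightInt_eq_conv β _ hs, rightInt_edgeL2 hβ1 hs, coe_testDeriv]
    _ = -∫ s in Ioo (0 : ℝ) 1, 0 * φ s :=
        setIntegral_mul_deriv_test (fun s => hasDerivAt_const s c) continuous_const φ
    _ = 0 := by simp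

theorem not_surjective_twoSidedDeriv_one (hβ : 0 < β) (hβ1 : β < 1 / 2) :
    ¬ Function.Surjective (twoSidedDeriv hβ 1) := by
  intro hs
  obtain ⟨v, hv⟩ := hs (edgeL2 hβ1)
  rw [twoSidedDeriv_apply, one_smul, sub_self, zero_smul, add_zero] at hv
  obtain ⟨φ, hφ⟩ := exists_seq_tendsto_of_mem_closure_range v.2
  have horth : inner ℝ (edgeL2 hβ1) (v : L2 × L2).1 = 0 :=
    tendsto_nhds_unique (tendsto_const_nhds.inner hφ.fst_nhds)
      (by simp only [inner_edgeL2_oneSidedDerivs_fst, tendsto_const_nhds])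
  rw [hv, inner_self_eq_zero] at horth
  exact edgeL2_ne_zero hβ1 horth

end TwoSidedDerivative

/-! ### Solvability modulo constants -/

theorem tendsto_testL2_zero_of_tendsto_energy {s : ℝ} (hs : 0 ≤ s) {φ : ℕ → Test}
    (h : Tendsto (fun n => energy s (φ n)) atTop (𝓝 0)) :
    Tendsto (fun n => testL2 (φ n)) atTop (𝓝 0) := by
  have hsq : Tendsto (fun n => ‖testL2 (φ n)‖ ^ 2) atTop (𝓝 0) :=
    squeeze_zero (fun _ => sq_nonneg _) (fun n => norm_testL2_sq_le hs (φ n))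
      (by simpa using h.const_mul (2 * (4 : ℝ) ^ (2 * s)))
  rw [tendsto_zero_iff_norm_tendsto_zero]
  simpa using hsq.sqrt

theorem energy_le_norm_testDerivL2_sq {s : ℝ} (hs0 : 0 ≤ s) (hs1 : s ≤ 1) (φ : Test) :
    energy s φ ≤ 2 * ‖testDerivL2 φ‖ ^ 2 := by
  have hone : energy 1 φ ≤ ‖testDerivL2 φ‖ ^ 2 := by
    rw [norm_testDerivL2_sq]
    exact le_mul_of_one_le_left (energy_nonneg 1 φ) (by nlinarith [Real.pi_gt_three])
  linarith [energy_le hs0 hs1 φ, norm_testL2_sq φ, norm_testL2_sq_le_norm_testDerivL2_sq φ]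

section Solvability

variable {β θ : ℝ}

theorem eq_zero_of_inner_twoSidedDeriv_eq_zero (hβ : 0 < β) (hβ1 : β < 1) (hθ0 : 0 ≤ θ)
    (hθ1 : θ ≤ 1) {h : L2} (hmean : inner ℝ oneL2 h = 0)
    (horth : ∀ v, inner ℝ (twoSidedDeriv hβ θ v) h = 0) : h = 0 := by
  obtain ⟨φ, hφ⟩ := exists_seq_testDerivL2 hmean
  have hE : EnergyCauchy (1 - β) φ := .of_cauchySeq hφ.cauchySeq
    (energy_le_norm_testDerivL2_sq (by linarith) (by linarith))
  obtain ⟨v, hv⟩ := hE.exists_tendsto_oneSidedDerivs hβ hβ1.le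
  have hinner := ((hv.fst_nhds.const_smul θ).add (hv.snd_nhds.const_smul (1 - θ))).inner (𝕜 := ℝ) hφ
  rw [← twoSidedDeriv_apply, horth v] at hinner
  have hcos : 0 < Real.cos (β * (Real.pi / 2)) * (2 * Real.pi) ^ (2 - β) :=
    mul_pos (Real.cos_pos_of_mem_Ioo ⟨by nlinarith [Real.pi_pos], by nlinarith [Real.pi_pos]⟩)
      (by positivity)
  have henergy : Tendsto (fun n => energy (1 - β / 2) (φ n)) atTop (𝓝 0) := by
    have hbound := hinner.const_mul (Real.cos (β * (Real.pi / 2)) * (2 * Real.pi) ^ (2 - β))⁻¹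
    rw [mul_zero] at hbound
    refine squeeze_zero (fun _ => energy_nonneg _ _) (fun n => ?_) hbound
    rw [← div_eq_inv_mul, le_div_iff₀' hcos, mul_assoc]
    exact le_inner_oneSidedDerivs_testDerivL2 hβ (by linarith) hθ0 hθ1 (φ n)
  have hzero := tendsto_testL2_zero_of_tendsto_energy (by linarith) henergy
  have hweak : HasWeakDeriv 0 h := .of_tendsto (fun n => hasWeakDeriv_test (φ n)) hzero hφ
  exact hweak.unique (by simpa using hasWeakDeriv_oneL2.smul 0)

theorem isClosed_range_twoSidedDeriv (hβ : 0 < β) (hβ1 : β < 1 / 2) (hθ0 : 0 ≤ θ) (hθ1 : θ ≤ 1) :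
    IsClosed ((twoSidedDeriv hβ θ).range : Set L2) := by
  have hc : 0 < Real.cos (β * Real.pi) / 2 := half_pos (cos_mul_pi_pos hβ hβ1)
  have hanti : AntilipschitzWith (Real.toNNReal (Real.cos (β * Real.pi) / 2)⁻¹)
      (twoSidedDeriv hβ θ) := by
    refine ContinuousLinearMap.antilipschitz_of_bound _ fun v => ?_
    rw [Real.coe_toNNReal _ (inv_pos.2 hc).le, ← div_eq_inv_mul, le_div_iff₀' hc]
    exact norm_le_norm_twoSidedDeriv hβ hβ1.le hθ0 hθ1 v
  exact hanti.isClosed_range (twoSidedDeriv hβ θ).uniformContinuous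

theorem exists_eq_twoSidedDeriv_add (hβ : 0 < β) (hβ1 : β < 1 / 2) (hθ0 : 0 ≤ θ) (hθ1 : θ ≤ 1)
    (h : L2) : ∃ (v : oneSidedDerivSpace hβ) (a : ℝ), h = twoSidedDeriv hβ θ v + a • oneL2 := by
  set S := (twoSidedDeriv hβ θ).range ⊔ Submodule.span ℝ {oneL2}
  have hclosed : IsClosed (S : Set L2) :=
    Submodule.isClosed_sup_finiteDimensional _ _ (isClosed_range_twoSidedDeriv hβ hβ1 hθ0 hθ1)
  have : CompleteSpace S := hclosed.completeSpace_coe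
  have htop : S = ⊤ := by
    rw [← Submodule.orthogonal_eq_bot_iff, Submodule.eq_bot_iff]
    intro g hg
    rw [Submodule.mem_orthogonal] at hg
    exact eq_zero_of_inner_twoSidedDeriv_eq_zero hβ (by linarith) hθ0 hθ1
      (hg _ (Submodule.mem_sup_right (Submodule.mem_span_singleton_self _)))
      fun v => hg _ (Submodule.mem_sup_left ⟨v, rfl⟩)
  obtain ⟨_, ⟨v, rfl⟩, z, hz, rfl⟩ := Submodule.mem_sup.1 (htop ▸ Submodule.mem_top : h ∈ S)
  obtain ⟨a, rfl⟩ := Submodule.mem_span_singleton.1 hz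
  exact ⟨v, a, rfl⟩

theorem continuous_smul_add_one_sub_smul {E : Type*} [NormedAddCommGroup E] [NormedSpace ℝ E]
    (a b : E) : Continuous fun t : ℝ => t • a + (1 - t) • b := by
  fun_prop

theorem continuous_twoSidedDeriv (hβ : 0 < β) : Continuous (twoSidedDeriv hβ) :=
  continuous_smul_add_one_sub_smul (E := oneSidedDerivSpace hβ →L[ℝ] L2) _ _

theorem not_surjective_twoSidedDeriv (hβ : 0 < β) (hβ1 : β < 1 / 2) (hθ0 : 0 ≤ θ) (hθ1 : θ ≤ 1) :
    ¬ Function.Surjective (twoSidedDeriv hβ θ) := fun hs =>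
  not_surjective_twoSidedDeriv_one hβ hβ1 <|
    surjective_of_surjective_of_continuous (T := fun t : unitInterval => twoSidedDeriv hβ t)
      ((continuous_twoSidedDeriv hβ).comp continuous_subtype_val) (half_pos (cos_mul_pi_pos hβ hβ1))
      (fun t => norm_le_norm_twoSidedDeriv hβ hβ1.le t.2.1 t.2.2) (x := ⟨θ, hθ0, hθ1⟩) hs 1

theorem eq_zero_of_twoSidedDeriv_eq_smul (hβ : 0 < β) (hβ1 : β < 1 / 2) (hθ0 : 0 ≤ θ)
    (hθ1 : θ ≤ 1) {v : oneSidedDerivSpace hβ} {a : ℝ} (h : twoSidedDeriv hβ θ v = a • oneL2) :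
    v = 0 := by
  rcases eq_or_ne a 0 with rfl | ha
  · have hv := norm_le_norm_twoSidedDeriv hβ hβ1.le hθ0 hθ1 v
    rw [h, zero_smul, norm_zero] at hv
    exact norm_le_zero_iff.1
      (nonpos_of_mul_nonpos_right hv (half_pos (cos_mul_pi_pos hβ hβ1)))
  · refine absurd (fun y => ?_) (not_surjective_twoSidedDeriv hβ hβ1 hθ0 hθ1)
    obtain ⟨w, b, hw⟩ := exists_eq_twoSidedDeriv_add hβ hβ1 hθ0 hθ1 y
    refine ⟨w + (b / a) • v, ?_⟩
    rw [map_add, map_smul, h, smul_smul, div_mul_cancel₀ _ ha, hw]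

/-! ### The range of the two-sided fractional integral -/

theorem fracInt_ae_eq (β θ : ℝ) (u : L2) :
    fracInt β θ u =ᵐ[vol01] fun x => θ * (unitKernel β ⋆ᵣ zeroExt u) x
      + (1 - θ) * ((fun t => unitKernel β (-t)) ⋆ᵣ zeroExt u) x := by
  filter_upwards [ae_restrict_mem measurableSet_Ioo] with x hx
  rw [fracInt, leftInt_eq_conv β u hx, rightInt_eq_conv β u hx]

theorem exists_hasWeakDeriv_fracInt (hβ : 0 < β) (θ : ℝ) {φ : ℕ → Test} {u : L2} {v : L2 × L2}
    (hu : Tendsto (fun n => testL2 (φ n)) atTop (𝓝 u))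
    (hv : Tendsto (fun n => oneSidedDerivs hβ (φ n)) atTop (𝓝 v)) :
    ∃ w : L2, w =ᵐ[vol01] fracInt β θ u ∧ HasWeakDeriv w (θ • v.1 + (1 - θ) • v.2) := by
  obtain ⟨l, hl, hl'⟩ := exists_hasWeakDeriv_ae_eq
    (integrable_conv (integrable_unitKernel hβ) (zeroExt_integrable u)).integrableOn
    (setIntegral_conv_mul_deriv _ hu hv.fst_nhds)
  obtain ⟨r, hr, hr'⟩ := exists_hasWeakDeriv_ae_eq
    (integrable_conv (integrable_unitKernel_neg hβ) (zeroExt_integrable u)).integrableOn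
    (setIntegral_conv_mul_deriv _ hu hv.snd_nhds)
  refine ⟨θ • l + (1 - θ) • r, ?_, (hl'.smul θ).add (hr'.smul (1 - θ))⟩
  filter_upwards [fracInt_ae_eq β θ u, hl, hr, Lp.coeFn_add (θ • l) ((1 - θ) • r),
    Lp.coeFn_smul θ l, Lp.coeFn_smul (1 - θ) r] with x hfrac hlx hrx hadd hsl hsr
  rw [hfrac, hadd, Pi.add_apply, hsl, hsr, Pi.smul_apply, Pi.smul_apply, hlx, hrx, smul_eq_mul,
    smul_eq_mul]

theorem exists_mem_fracRange_D_eq (hβ : 0 < β) (hβ1 : β < 1 / 2) (θ : ℝ)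
    (v : oneSidedDerivSpace hβ) : ∃ w ∈ fracRange β θ hβ, D w = twoSidedDeriv hβ θ v := by
  have hs : 0 ≤ 1 - β := by linarith
  obtain ⟨φ, hφ⟩ := exists_seq_tendsto_of_mem_closure_range v.2
  have hE : EnergyCauchy (1 - β) φ :=
    .of_cauchySeq hφ.cauchySeq (energy_le_norm_oneSidedDerivs_sq hβ hβ1)
  obtain ⟨u, hu⟩ := hE.exists_tendsto hs
  obtain ⟨w, hw, hw'⟩ := exists_hasWeakDeriv_fracInt hβ θ hu hφ
  exact ⟨⟨w, _, hw'⟩, ⟨u, hE.mem_Hzero hs hu, hw⟩, D_eq hw'⟩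

theorem eq_zero_of_ae_eq_fracInt_zero {w : L2} (hw : w =ᵐ[vol01] fracInt β θ (0 : L2)) :
    w = 0 := by
  refine Lp.ext ?_
  have hzero := fracInt_smul (β := β) (θ := θ) 0 0
  rw [zero_smul, zero_smul] at hzero
  filter_upwards [Lp.coeFn_zero ℝ 2 vol01, hzero, hw] with x hx hfrac hwx
  rw [hwx, hfrac, hx]

theorem tendsto_testL2_zero_of_tendsto_oneSidedDerivs (hβ : 0 < β) (hβ1 : β < 1 / 2)
    {φ : ℕ → Test} (h : Tendsto (fun n => oneSidedDerivs hβ (φ n)) atTop (𝓝 0)) :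
    Tendsto (fun n => testL2 (φ n)) atTop (𝓝 0) := by
  refine tendsto_testL2_zero_of_tendsto_energy (s := 1 - β) (by linarith) ?_
  have hbound := (h.norm.pow 2).const_mul
    (Real.cos (β * Real.pi) * (2 * Real.pi) ^ (2 - 2 * β))⁻¹
  rw [norm_zero, zero_pow two_ne_zero, mul_zero] at hbound
  exact squeeze_zero (fun _ => energy_nonneg _ _)
    (fun n => energy_le_norm_oneSidedDerivs_sq hβ hβ1 (φ n)) hbound

theorem exists_D_eq_twoSidedDeriv (hβ : 0 < β) (hβ1 : β < 1 / 2) {w : H1}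
    (hw : w ∈ fracRange β θ hβ) :
    ∃ v : oneSidedDerivSpace hβ, D w = twoSidedDeriv hβ θ v ∧ (v = 0 → w = 0) := by
  obtain ⟨u, hu, hwu⟩ := hw
  obtain ⟨φ, hE, hφ⟩ := exists_energyCauchy (by linarith) hu
  obtain ⟨v, hv⟩ := hE.exists_tendsto_oneSidedDerivs hβ (by linarith)
  obtain ⟨w', hw', hderiv⟩ := exists_hasWeakDeriv_fracInt hβ θ hφ hv
  have hww' : (w : L2) = w' := Lp.ext (hwu.trans hw'.symm)
  refine ⟨v, D_eq (hww' ▸ hderiv), ?_⟩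
  rintro rfl
  obtain rfl : u = 0 :=
    tendsto_nhds_unique hφ (tendsto_testL2_zero_of_tendsto_oneSidedDerivs hβ hβ1 hv)
  exact Subtype.ext (eq_zero_of_ae_eq_fracInt_zero hwu)

end Solvability

/-! ### The projection onto `H¹₀(0, 1)` -/

/-- The square integrable functions of mean zero. -/
noncomputable def meanZero : Submodule ℝ L2 := LinearMap.ker (innerₗ L2 oneL2)

/-- Subtraction of the mean, the orthogonal projection onto the functions of mean zero. -/
noncomputable def subMean : L2 →ₗ[ℝ] meanZero :=
  LinearMap.codRestrict meanZero (LinearMap.id - (innerₗ L2 oneL2).smulRight oneL2)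
    inner_oneL2_sub

theorem coe_subMean (g : L2) : (subMean g : L2) = g - (inner ℝ oneL2 g : ℝ) • oneL2 := rfl

/-- The weak derivative as an isomorphism of `H¹₀(0, 1)` onto the functions of mean zero. -/
noncomputable def derivEquiv : H10 ≃ₗ[ℝ] meanZero :=
  LinearEquiv.ofBijective (LinearMap.codRestrict meanZero (D ∘ₗ H10.subtype) inner_oneL2_D)
    ⟨(injective_iff_map_eq_zero _).2 fun _ hw => eq_zero_of_D_eq_zero (congrArg Subtype.val hw),
      fun ⟨_, hg⟩ => (exists_H10_D_eq hg).imp fun _ hw => Subtype.ext hw⟩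

theorem coe_derivEquiv (w : H10) : (derivEquiv w : L2) = D (w : H1) := rfl

/-- The `H¹`-projection `P` onto `H¹₀(0, 1)`: the derivative of `Pw` is that of `w` minus its
mean. -/
noncomputable def h1Projection : H1 →ₗ[ℝ] H10 := derivEquiv.symm.toLinearMap ∘ₗ subMean ∘ₗ D

theorem D_h1Projection (w : H1) :
    D (h1Projection w : H1) = D w - (inner ℝ oneL2 (D w) : ℝ) • oneL2 := by
  rw [← coe_derivEquiv, ← coe_subMean]
  exact congrArg Subtype.val (derivEquiv.apply_symm_apply _)

theorem isH1Projection_h1Projection : IsH1Projection h1Projection := by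
  intro w v
  rw [D_h1Projection, inner_sub_left, real_inner_smul_left, inner_oneL2_D, mul_zero, sub_zero]

theorem IsH1Projection.eq_h1Projection {Q : H1 → H10} (hQ : IsH1Projection Q) :
    Q = h1Projection := by
  ext1 w
  rw [← sub_eq_zero]
  refine eq_zero_of_D_eq_zero (inner_self_eq_zero (𝕜 := ℝ).1 ?_)
  have h := (hQ w (Q w - h1Projection w)).trans
    (isH1Projection_h1Projection w (Q w - h1Projection w)).symm
  rwa [← sub_eq_zero, ← inner_sub_left, ← map_sub] at h

theorem mem_ker_h1Projection {w : H1} :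
    w ∈ LinearMap.ker h1Projection ↔ ∃ c : ℝ, D w = c • oneL2 := by
  rw [LinearMap.mem_ker]
  constructor
  · intro h
    refine ⟨inner ℝ oneL2 (D w), sub_eq_zero.1 ?_⟩
    rw [← D_h1Projection, h, ZeroMemClass.coe_zero, map_zero]
  · rintro ⟨c, hc⟩
    refine eq_zero_of_D_eq_zero ?_
    rw [D_h1Projection, hc, real_inner_smul_right, real_inner_self_eq_norm_sq, norm_oneL2,
      one_pow, mul_one, sub_self]

theorem wl_add_wr : wl + wr = oneL2 := by
  refine Lp.ext ?_
  filter_upwards [Lp.coeFn_add wl wr, coeFn_contL2 (f := fun x => 1 - x) (by fun_prop),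
    coeFn_contL2 (f := fun x => x) (by fun_prop),
    coeFn_contL2 (f := fun _ => 1) continuous_const] with x hadd hl hr hone
  rw [hadd, Pi.add_apply]
  exact (congrArg₂ (· + ·) hl hr).trans ((sub_add_cancel 1 x).trans hone.symm)

theorem map_ker_h1Projection :
    (LinearMap.ker h1Projection).map H1.subtype = Submodule.span ℝ {wl, wr} := by
  ext w
  rw [Submodule.mem_span_pair]
  constructor
  · rintro ⟨w, hw, rfl⟩
    obtain ⟨c, hc⟩ := mem_ker_h1Projection.1 hw
    have hweak : HasWeakDeriv ((w : L2) + (-c) • wr) 0 := by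
      have h := (D_spec w).add (hasWeakDeriv_wr.smul (-c))
      rwa [hc, ← add_smul, add_neg_cancel, zero_smul] at h
    obtain ⟨d, hd⟩ := exists_eq_smul_oneL2 fun φ => by
      rw [hasWeakDeriv_iff_inner.1 hweak, inner_zero_left, neg_zero]
    refine ⟨d, c + d, ?_⟩
    rw [Submodule.coe_subtype, eq_sub_of_add_eq hd, ← wl_add_wr]
    module
  · rintro ⟨a, b, rfl⟩
    have h := (hasWeakDeriv_wl.smul a).add (hasWeakDeriv_wr.smul b)
    refine ⟨⟨a • wl + b • wr, _, h⟩, mem_ker_h1Projection.2 ⟨b - a, ?_⟩, rfl⟩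
    rw [D_eq h]
    module

section Decomposition

variable {β θ : ℝ}

theorem map_fracRange_h1Projection (hβ : 0 < β) (hβ1 : β < 1 / 2) (hθ0 : 0 ≤ θ) (hθ1 : θ ≤ 1) :
    (fracRange β θ hβ).map h1Projection = ⊤ := by
  rw [eq_top_iff]
  rintro z -
  obtain ⟨v, a, h⟩ := exists_eq_twoSidedDeriv_add hβ hβ1 hθ0 hθ1 (D (z : H1))
  obtain ⟨w, hw, hD⟩ := exists_mem_fracRange_D_eq hβ hβ1 θ v
  have hmean : inner ℝ oneL2 (twoSidedDeriv hβ θ v) = -a := by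
    have hz := inner_oneL2_D z
    rw [h, inner_add_right, real_inner_smul_right, real_inner_self_eq_norm_sq, norm_oneL2] at hz
    linarith
  refine ⟨w, hw, sub_eq_zero.1 (eq_zero_of_D_eq_zero ?_)⟩
  rw [Submodule.coe_sub, map_sub, D_h1Projection, hD, h, hmean]
  module

theorem isCompl_fracRange_ker (hβ : 0 < β) (hβ1 : β < 1 / 2) (hθ0 : 0 ≤ θ) (hθ1 : θ ≤ 1) :
    IsCompl (fracRange β θ hβ) (LinearMap.ker h1Projection) := by
  constructor
  · rw [Submodule.disjoint_def]
    intro w hw hker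
    obtain ⟨c, hc⟩ := mem_ker_h1Projection.1 hker
    obtain ⟨v, hv, hzero⟩ := exists_D_eq_twoSidedDeriv hβ hβ1 hw
    exact hzero (eq_zero_of_twoSidedDeriv_eq_smul hβ hβ1 hθ0 hθ1 (hv.symm.trans hc))
  · rw [codisjoint_iff, eq_top_iff]
    rintro w -
    have hmem : h1Projection w ∈ (fracRange β θ hβ).map h1Projection :=
      map_fracRange_h1Projection hβ hβ1 hθ0 hθ1 ▸ Submodule.mem_top
    obtain ⟨r, hr, hrw⟩ := hmem
    refine Submodule.mem_sup.2 ⟨r, hr, w - r, ?_, add_sub_cancel _ _⟩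
    rw [LinearMap.mem_ker, map_sub, hrw, sub_self]

end Decomposition

end FracDiff

theorem theorem4p2 (β θ : ℝ) (hβ0 : 0 < β) (hβ1 : β < 1 / 2) (hθ0 : 0 ≤ θ) (hθ1 : θ ≤ 1) :
    ∃ P : FracDiff.H1 →ₗ[ℝ] FracDiff.H10,
      -- `P` is the `H¹`-projection onto `H¹₀`, which exists, is unique, and is linear
      (FracDiff.IsH1Projection P ∧
        ∀ Q : FracDiff.H1 → FracDiff.H10, FracDiff.IsH1Projection Q → Q = P) ∧
      -- `N(P) = span {1 - x, x}`
      (LinearMap.ker P).map FracDiff.H1.subtype = Submodule.span ℝ {FracDiff.wl, FracDiff.wr} ∧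
      -- `P (R(I^β_θ)) = H¹₀(0, 1)`
      (FracDiff.fracRange β θ hβ0).map P = ⊤ ∧
      -- `H¹(0, 1) = R(I^β_θ) ⊕ N(P)`
      IsCompl (FracDiff.fracRange β θ hβ0) (LinearMap.ker P) :=
  ⟨FracDiff.h1Projection,
    ⟨FracDiff.isH1Projection_h1Projection, fun _ hQ => hQ.eq_h1Projection⟩,
    FracDiff.map_ker_h1Projection,
    FracDiff.map_fracRange_h1Projection hβ0 hβ1 hθ0 hθ1,
    FracDiff.isCompl_fracRange_ker hβ0 hβ1 hθ0 hθ1⟩
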